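/- Let $G=\mathbb Z^d$, let $S^1=\mathbb R/2\pi\mathbb Z$ with Lebesgue measure $\lambda$, let $q\ge 1$ be an integer, and let $T:S^1\to\mathbb Z_q$ be the equal-arc discretization, $T(\varphi)=k$ iff $2\pi k/q\le\varphi<2\pi(k+1)/q$ for $\varphi\in[0,2\pi)$, $k\in\{0,\dots,q-1\}$; apply $T$ sitewise to configurations. Let $\Phi=(\Phi_A)_{A\subset G\text{ finite}}$ be a potential, where $\Phi_A$ is a measurable real function of the spins $(\sigma_i)_{i\in A}\in(S^1)^A$, which is absolutely summable ($\sum_{A\ni i}\|\Phi_A\|_\infty<\infty$ for all $i$), invariant under joint rotations of all spins, and invariant under lattice translations. Put $H_\Lambda=\sum_{A\cap\Lambda\ne\emptyset}\Phi_A$ for finite $\Lambda\subset G$. For $\sigma'\in\Omega:=\mathbb Z_q^G$ let $\gamma^{\sigma'}$ be the constrained specification $$\gamma^{\sigma'}_\Lambda(B|\eta)=\frac{\int 1_B(\sigma_\Lambda\eta_{\Lambda^c})\,1_{T(\sigma_\Lambda)=\sigma'_\Lambda}\,e^{-H_\Lambda(\sigma_\Lambda\eta_{\Lambda^c})}\,\lambda^{\otimes\Lambda}(d\sigma_\Lambda)}{\int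 1_{T(\sigma_\Lambda)=\sigma'_\Lambda}\,e^{-H_\Lambda(\sigma_\Lambda\eta_{\Lambda^c})}\,\lambda^{\otimes\Lambda}(d\sigma_\Lambda)} .$$ Assume that $\gamma^{\sigma'}$ satisfies Dobrushin's uniqueness condition for every $\sigma'\in\Omega$: $\sup_i\sum_j C_{ij}(\gamma^{\sigma'})<1$, where $C_{ij}(\gamma^{\sigma'})$ is the supremum of the total variation distance between the laws of $\sigma_i$ under $\gamma^{\sigma'}_{\{i\}}(\cdot|\eta)$ and $\gamma^{\sigma'}_{\{i\}}(\cdot|\tilde\eta)$ over all $\eta,\tilde\eta$ with $T(\eta)=T(\tilde\eta)=\sigma'$ and $\eta=\tilde\eta$ off $j$. Let $\mu_G[\sigma']$ be the unique Gibbs measure for $\gamma^{\sigma'}$, and for finite $\Lambda\subset G$ let $\mu_{\Lambda^c}[\sigma'_{\Lambda^c}]$ be the unique Gibbs measure of the analogous constrained model on the site set $\Lambda^c$ with potential $(\Phi_A)_{A\subset\Lambda^c}$. Let $\gamma'$ be the family of kernels on $\Omega$ given by $$\gamma'_\Lambda(\omega'_\Lambda|\sigma'_{\Lambda^c})=\frac{\int\mu_{\Lambda^c}[\sigma'_{\Lambda^c}](d\zeta)\int\lambda^{\otimes\Lambda}(d\sigma_\Lambda)\,e^{-H_\Lambda(\sigma_\Lambda\zeta)}\,1_{T(\sigma_\Lambda)=\omega'_\Lambda}}{\int\mu_{\Lambda^c}[\sigma'_{\Lambda^c}](d\zeta)\int\lambda^{\otimes\Lambda}(d\sigma_\Lambda)\,e^{-H_\Lambda(\sigma_\Lambda\zeta)}}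 .$$ For $\tau\in\mathbb R$ let $M_\tau(\sigma',\cdot)$ be the law of $T(\sigma+\tau)$, where $\sigma$ has law $\mu_G[\sigma']$ and $\tau$ is added at every site. Then every $M_\tau$, $\tau\in\mathbb R$, is a Markov kernel on $\Omega$, and for every $\tau\in\mathbb R$ and every lattice-translation-invariant Gibbs measure $\mu'$ for $\gamma'$ the backward transition operator of $M_\tau$ with respect to $\mu'$ is $M_{-\tau}$. That is, with $Q_{\mu'}(d\sigma',d\eta')=\mu'(d\sigma')M_\tau(\sigma',d\eta')$, the kernel $M_{-\tau}(\eta',d\sigma')$ is a version of the regular conditional distribution $Q_{\mu'}(d\sigma'|\eta')$ (it agrees with it for $M_\tau\mu'$-almost every $\eta'$), and $$\int\mu'(d\sigma')\int M_\tau(\sigma',d\eta')\,f(\sigma',\eta')=\int (M_\tau\mu')(d\eta')\int M_{-\tau}(\eta',d\sigma')\,f(\sigma',\eta')$$ for all bounded measurable $f:\Omega\times\Omega\to\mathbb R$, in particular for all local $f$. -/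

import Mathlib

open MeasureTheory ProbabilityTheory
open scoped ENNReal Real

namespace RotatorPCA

noncomputable section

instance fact_two_pi_pos : Fact (0 < 2 * π) := ⟨Real.two_pi_pos⟩

/-- The circle `S¹ = ℝ / 2πℤ`; its `volume` is Lebesgue measure, of total mass `2π`. -/
abbrev Angle : Type := AddCircle (2 * π)

/-- The equal-arc discretization `T`: `T φ = k` iff `2πk/q ≤ φ < 2π(k+1)/q`, where the angle `φ` is
represented in `[0, 2π)`. -/
def disc (q : ℕ) (φ : Angle) : ZMod q :=
  ((⌊(q : ℝ) * (AddCircle.equivIco (2 * π) 0 φ : ℝ) / (2 * π)⌋₊ : ℕ) : ZMod q)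

section General

variable {I : Type} {E : Type}

open Classical in
/-- The configuration equal to `s` on `Λ` and to `ζ` off `Λ`. -/
def join (Λ : Finset I) (s : Λ → E) (ζ : {i // i ∉ Λ} → E) : I → E :=
  fun i => if h : i ∈ Λ then s ⟨i, h⟩ else ζ ⟨i, h⟩

/-- `μ` is a Gibbs measure for the family of kernels `γ` indexed by finite volumes: a probability
measure satisfying the DLR equation `∫ μ(dη) γ_Λ(B|η) = μ(B)` in every finite volume. -/
def IsGibbs [MeasurableSpace E] (γ : Finset I → (I → E) → Measure (I → E))
    (μ : Measure (I → E)) : Prop :=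
  IsProbabilityMeasure μ ∧
    ∀ (Λ : Finset I) (B : Set (I → E)), MeasurableSet B → ∫⁻ η, γ Λ η B ∂μ = μ B

end General

/-- An interaction potential on the site set `I`: a function `Φ_A` of the spins in `A` for every
finite set `A` of sites. -/
abbrev Potential (I : Type) : Type := (A : Finset I) → (A → Angle) → ℝ

namespace Potential

variable {I : Type}

/-- `∑_{A ∋ i} sup |Φ_A| < ∞` for every site `i`. -/
def AbsolutelySummable (Φ : Potential I) : Prop :=
  ∀ i : I, (∑' A : {A : Finset I // i ∈ A}, (⨆ s : (A.1 → Angle), ‖Φ A.1 s‖ₑ)) < ∞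

/-- Invariance under a joint rotation of all spins. -/
def RotationInvariant (Φ : Potential I) : Prop :=
  ∀ (t : Angle) (A : Finset I) (s : A → Angle), Φ A (fun a => s a + t) = Φ A s

/-- Invariance under lattice translations. -/
def TranslationInvariant {d : ℕ} (Φ : Potential (Fin d → ℤ)) : Prop :=
  ∀ (k : Fin d → ℤ) (A : Finset (Fin d → ℤ))
    (s : (A.map (addRightEmbedding k) : Finset (Fin d → ℤ)) → Angle),
    Φ (A.map (addRightEmbedding k)) s =
      Φ A (fun a => s ⟨a.1 + k, Finset.mem_map_of_mem (addRightEmbedding k) a.2⟩)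

/-- The potential on the smaller site set `{i // p i}` that keeps exactly the interactions `Φ_A`
with `A` inside it and deletes all others. -/
def restrict (Φ : Potential I) (p : I → Prop) : Potential {i // p i} :=
  fun A s => Φ (A.map (Function.Embedding.subtype p)) fun a =>
    s ⟨⟨a.1, Finset.property_of_mem_map_subtype A a.2⟩, by
      obtain ⟨x, hx, hxa⟩ := Finset.mem_map.1 a.2
      have hx' : x = ⟨a.1, Finset.property_of_mem_map_subtype A a.2⟩ := Subtype.ext hxa
      exact hx' ▸ hx⟩

/-- The Hamiltonian `H_Λ = ∑_{A ∩ Λ ≠ ∅} Φ_A`. -/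
def hamiltonian (Φ : Potential I) (Λ : Finset I) (σ : I → Angle) : ℝ :=
  ∑' A : {A : Finset I // ∃ i ∈ A, i ∈ Λ}, Φ A.1 (fun a => σ a)

variable (q : ℕ)

open Classical in
/-- The integral `λ^{⊗Λ}(exp(-H_Λ(· η_{Λᶜ})) 1_{κ})`, that is the partition function in `Λ` restricted
to the spins with discretization `κ`. -/
def constrainedPartition (Φ : Potential I) (Λ : Finset I) (κ : Λ → ZMod q)
    (η : {i // i ∉ Λ} → Angle) : ℝ≥0∞ :=
  ∫⁻ s : Λ → Angle, (if ∀ i, disc q (s i) = κ i then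
    ENNReal.ofReal (Real.exp (-Φ.hamiltonian Λ (join Λ s η))) else 0)
    ∂(Measure.pi fun _ : Λ => (volume : Measure Angle))

open Classical in
/-- The first-layer specification constrained to configurations `σ` with `T(σ) = σ'`. -/
def constrainedSpec (Φ : Potential I) (σ' : I → ZMod q) (Λ : Finset I) (η : I → Angle) :
    Measure (I → Angle) :=
  (Φ.constrainedPartition q Λ (fun i => σ' i) (fun i => η i))⁻¹ •
    ((Measure.pi fun _ : Λ => (volume : Measure Angle)).withDensity fun s =>
      if ∀ i, disc q (s i) = σ' i then
        ENNReal.ofReal (Real.exp (-Φ.hamiltonian Λ (join Λ s fun i => η i))) else 0).map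
      fun s => join Λ s fun i => η i

open Classical in
/-- The constrained measure `μ_I[σ']`: the unique Gibbs measure for the first-layer specification
constrained to `T(σ) = σ'` (and the zero measure if there is not exactly one). -/
def constrainedGibbs (Φ : Potential I) (σ' : I → ZMod q) : Measure (I → Angle) :=
  if h : ∃! μ : Measure (I → Angle), IsGibbs (Φ.constrainedSpec q σ') μ then h.choose else 0

/-- Dobrushin's interdependence coefficient `C_{ij}` of the specification constrained to
`T(σ) = σ'`: the largest total variation distance of the single-site distributions at `i` for two
admissible boundary conditions that agree off `j`. -/
def interdependence (Φ : Potential I) (σ' : I → ZMod q) (i j : I) : ℝ≥0∞ :=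
  ⨆ (η : I → Angle) (η₂ : I → Angle) (_ : ∀ k, disc q (η k) = σ' k)
    (_ : ∀ k, disc q (η₂ k) = σ' k) (_ : ∀ k, k ≠ j → η k = η₂ k)
    (B : Set Angle) (_ : MeasurableSet B),
    Φ.constrainedSpec q σ' {i} η {σ | σ i ∈ B} - Φ.constrainedSpec q σ' {i} η₂ {σ | σ i ∈ B}

/-- Dobrushin's uniqueness condition `sup_i ∑_j C_{ij} < 1` holds for all the constrained
first-layer models. -/
def ConstrainedDobrushin (Φ : Potential I) : Prop :=
  ∀ σ' : I → ZMod q, (⨆ i, (∑' j, Φ.interdependence q σ' i j)) < 1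

/-- The weight `μ_{Λᶜ}[σ'_{Λᶜ}](λ^Λ(e^{-H_Λ} 1_{ω}))`, where `μ_{Λᶜ}[σ'_{Λᶜ}]` is the constrained Gibbs
measure on `Λᶜ` with all interactions with `Λ` deleted. -/
def coarseWeight (Φ : Potential I) (Λ : Finset I) (ω : Λ → ZMod q) (σ' : I → ZMod q) : ℝ≥0∞ :=
  ∫⁻ ζ, Φ.constrainedPartition q Λ ω ζ
    ∂((Φ.restrict fun i => i ∉ Λ).constrainedGibbs q fun i => σ' i)

/-- The total weight `μ_{Λᶜ}[σ'_{Λᶜ}](λ^Λ(e^{-H_Λ}))`. -/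
def coarseTotal (Φ : Potential I) (Λ : Finset I) (σ' : I → ZMod q) : ℝ≥0∞ :=
  ∫⁻ ζ, ∫⁻ s : Λ → Angle, ENNReal.ofReal (Real.exp (-Φ.hamiltonian Λ (join Λ s ζ)))
    ∂(Measure.pi fun _ : Λ => (volume : Measure Angle))
    ∂((Φ.restrict fun i => i ∉ Λ).constrainedGibbs q fun i => σ' i)

/-- The second-layer specification `γ'`: given `σ'` off `Λ`, the configuration `ω` in `Λ` has
probability
`μ_{Λᶜ}[σ'_{Λᶜ}](λ^Λ(e^{-H_Λ} 1_{ω})) / μ_{Λᶜ}[σ'_{Λᶜ}](λ^Λ(e^{-H_Λ}))`. -/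
def coarseSpec (Φ : Potential I) (Λ : Finset I) (σ' : I → ZMod q) : Measure (I → ZMod q) :=
  Measure.sum fun ω : Λ → ZMod q =>
    (Φ.coarseWeight q Λ ω σ' / Φ.coarseTotal q Λ σ') • Measure.dirac (join Λ ω fun i => σ' i)

/-- The transition operator `M_τ(σ', ·)`: sample `σ` from `μ_G[σ']`, rotate all spins by `τ`, and
project with `T`. -/
def update (Φ : Potential I) (τ : ℝ) (σ' : I → ZMod q) : Measure (I → ZMod q) :=
  (Φ.constrainedGibbs q σ').map fun σ i => disc q (σ i + (τ : Angle))

end Potential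

/-- Invariance of a measure on configurations under all lattice shifts. -/
def ShiftInvariant {d : ℕ} {E : Type} [MeasurableSpace E] (μ : Measure ((Fin d → ℤ) → E)) : Prop :=
  ∀ k : Fin d → ℤ, μ.map (fun σ j => σ (j + k)) = μ

end

end RotatorPCA

set_option linter.unusedSectionVars false

namespace RotatorPCA

open Function Filter Topology

/-! Let `μ'` be a Gibbs measure of the second layer. Draw `σ'` from `μ'`, then `σ` from `μ_G[σ']`,
and let `μ` be the law of `σ`. As `T σ = σ'` almost surely, the joint law of the states before and
after the update is that of `(T σ, T (σ + τ))` under `μ`. The claim is thus about the conditional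
law of `T σ` given `T (σ + τ)`, and rests on three facts.

`μ` is a Gibbs measure of the unconstrained first layer (`dlr_bind_gibbsKernel`). The weights in
`γ'_Λ` are exactly the normalizations of the constrained Gibbs measures, so that mixing over the
discretization in `Λ` leaves one measure off `Λ`, extended into `Λ` by the full Boltzmann weight.

The rotated measure is again Gibbs, because the potential and Lebesgue measure are rotation
invariant (`dlr_map_rotate`).

Under any Gibbs measure of the first layer, the conditional law of the spins given their
discretization `η'` is `μ_G[η']` (`compProd_gibbsKernel`): almost surely it solves the constrained
DLR equations, which have a single solution.

Applied to the rotated measure, the last fact says that `σ + τ` has law `μ_G[η']` given `η' = T (σ +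
τ)`. Rotating back by `-τ` and discretizing gives `M_{-τ}(η', ·)` as the law of `T σ`
(`compProd_updateKernel_neg`).

Underneath lie Dobrushin's contraction for uniqueness (`eq_of_dobrushin`), compactness for existence
(`exists_isGibbs`), finite-volume limits for measurability in the constraint
(`measurable_constrainedGibbs`), and inheritance of uniqueness by the model off a finite set
(`existsUnique_isGibbs_restrict`). -/

lemma indicator_one_congr {X Y : Type*} {s : Set X} {t : Set Y} {x : X} {y : Y}
    (h : x ∈ s ↔ y ∈ t) : s.indicator (1 : X → ℝ≥0∞) x = t.indicator (1 : Y → ℝ≥0∞) y := by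
  by_cases hx : x ∈ s
  · simp [hx, h.1 hx]
  · simp [hx, mt h.2 hx]

/-! ### Integration over the spins in a finite volume -/

section Lmarginal

variable {I E : Type} [DecidableEq I] [MeasurableSpace E] {ν : Measure E}

lemma dependsOn_compl_iff {β : Type*} {V : Finset I} {u : (I → E) → β} :
    DependsOn u ((V : Set I)ᶜ) ↔ ∀ σ σ', (∀ i ∉ V, σ i = σ' i) → u σ = u σ' :=
  ⟨fun h σ σ' h' => h fun i hi => h' i (by simpa using hi),
    fun h σ σ' h' => h σ σ' fun i hi => h' i (by simpa using hi)⟩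

lemma dependsOn_updateFinset {β : Type*} {V : Finset I} {u : (I → E) → β}
    (hu : DependsOn u ((V : Set I)ᶜ)) (x : I → E) (s : V → E) :
    u (updateFinset x V s) = u x :=
  dependsOn_compl_iff.1 hu _ _ fun i hi => by simp [updateFinset, hi]

lemma lmarginal_mul_left (V : Finset I) {u f : (I → E) → ℝ≥0∞} (hf : Measurable f)
    (hu : DependsOn u ((V : Set I)ᶜ)) (x : I → E) :
    lmarginal (fun _ => ν) V (fun σ => u σ * f σ) x = u x * lmarginal (fun _ => ν) V f x := by
  simp only [lmarginal, dependsOn_updateFinset hu]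
  exact lintegral_const_mul _ (hf.comp measurable_updateFinset)

lemma dependsOn_lmarginal (V : Finset I) (f : (I → E) → ℝ≥0∞) :
    DependsOn (lmarginal (fun _ => ν) V f) ((V : Set I)ᶜ) :=
  dependsOn_compl_iff.2 fun _ _ h => lmarginal_congr _ f h

lemma lmarginal_of_subset [SigmaFinite ν] {V V' : Finset I} (h : V ⊆ V') {f : (I → E) → ℝ≥0∞}
    (hf : Measurable f) :
    lmarginal (fun _ => ν) V' f =
      lmarginal (fun _ => ν) (V' \ V) (lmarginal (fun _ => ν) V f) := by
  rw [← lmarginal_union _ f hf Finset.sdiff_disjoint, Finset.sdiff_union_of_subset h]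

end Lmarginal

/-! ### Abstract specifications given by weights, and the DLR equations -/

/-- A family of nonnegative weights, one for each finite volume, defining a specification with
a-priori measure `ν`. -/
structure IsWeight {I E : Type} [DecidableEq I] [MeasurableSpace E] (ν : Measure E)
    (w : Finset I → (I → E) → ℝ≥0∞) : Prop where
  measurable : ∀ V, Measurable (w V)
  ne_zero : ∀ V σ, lmarginal (fun _ => ν) V (w V) σ ≠ 0
  ne_top : ∀ V σ, lmarginal (fun _ => ν) V (w V) σ ≠ ∞
  consistent : ∀ V V' : Finset I, V ⊆ V' → ∃ u : (I → E) → ℝ≥0∞, Measurable u ∧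
    DependsOn u ((V : Set I)ᶜ) ∧ ∀ σ, w V' σ = u σ * w V σ

section Avg

variable {I E : Type} [DecidableEq I] [MeasurableSpace E]

/-- The expectation of `f` in the volume `V` given the boundary condition `η`. -/
noncomputable def avg (ν : Measure E) (w : Finset I → (I → E) → ℝ≥0∞) (V : Finset I) (f : (I → E) → ℝ≥0∞)
    (η : I → E) : ℝ≥0∞ :=
  (lmarginal (fun _ => ν) V (w V) η)⁻¹ * lmarginal (fun _ => ν) V (fun σ => w V σ * f σ) η

/-- The distribution in the volume `V` given the boundary condition `η`. -/
noncomputable def spec (ν : Measure E) (w : Finset I → (I → E) → ℝ≥0∞) (V : Finset I)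
    (η : I → E) : Measure (I → E) :=
  (lmarginal (fun _ => ν) V (w V) η)⁻¹ •
    ((Measure.pi fun _ : V => ν).withDensity fun s => w V (updateFinset η V s)).map
      (updateFinset η V)

/-- The DLR equation in the volume `V`. -/
def DLR (ν : Measure E) (w : Finset I → (I → E) → ℝ≥0∞) (V : Finset I)
    (μ : Measure (I → E)) : Prop :=
  ∀ f : (I → E) → ℝ≥0∞, Measurable f → ∫⁻ σ, avg ν w V f σ ∂μ = ∫⁻ σ, f σ ∂μ

variable {ν : Measure E} {w : Finset I → (I → E) → ℝ≥0∞}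

lemma lintegral_spec (hw : IsWeight ν w) (V : Finset I) (η : I → E) {f : (I → E) → ℝ≥0∞}
    (hf : Measurable f) : ∫⁻ σ, f σ ∂spec ν w V η = avg ν w V f η := by
  rw [spec, lintegral_smul_measure, lintegral_map hf measurable_updateFinset]
  congr 1
  exact lintegral_withDensity_eq_lintegral_mul _
    ((hw.measurable V).comp measurable_updateFinset) (hf.comp measurable_updateFinset)

lemma spec_apply (hw : IsWeight ν w) (V : Finset I) (η : I → E) {B : Set (I → E)}
    (hB : MeasurableSet B) : spec ν w V η B = avg ν w V (B.indicator 1) η := by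
  rw [← lintegral_spec hw V η (measurable_one.indicator hB), lintegral_indicator_one hB]

lemma dependsOn_avg (V : Finset I) (f : (I → E) → ℝ≥0∞) :
    DependsOn (avg ν w V f) ((V : Set I)ᶜ) := by
  intro x y h
  simp only [avg]
  rw [dependsOn_lmarginal V _ h, dependsOn_lmarginal V _ h]

lemma measurable_avg [SigmaFinite ν] (hw : IsWeight ν w) (V : Finset I) {f : (I → E) → ℝ≥0∞}
    (hf : Measurable f) : Measurable (avg ν w V f) :=
  ((hw.measurable V).lmarginal _).inv.mul (((hw.measurable V).mul hf).lmarginal _)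

lemma avg_one (hw : IsWeight ν w) (V : Finset I) (η : I → E) : avg ν w V 1 η = 1 := by
  simp only [avg, Pi.one_apply, mul_one]
  exact ENNReal.inv_mul_cancel (hw.ne_zero V η) (hw.ne_top V η)

lemma avg_mono (V : Finset I) {f g : (I → E) → ℝ≥0∞} (h : ∀ σ, f σ ≤ g σ) (η : I → E) :
    avg ν w V f η ≤ avg ν w V g η := by
  exact mul_le_mul_right (lmarginal_mono (fun σ => mul_le_mul_right (h σ) (w V σ)) η) _

lemma isProbabilityMeasure_spec (hw : IsWeight ν w) (V : Finset I) (η : I → E) :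
    IsProbabilityMeasure (spec ν w V η) :=
  ⟨by rw [spec_apply hw V η MeasurableSet.univ, Set.indicator_univ, avg_one hw]⟩

lemma lmarginal_weight_mul_avg [SigmaFinite ν] (hw : IsWeight ν w) (V : Finset I)
    {f : (I → E) → ℝ≥0∞} (η : I → E) :
    lmarginal (fun _ => ν) V (fun σ => w V σ * avg ν w V f σ) η =
      lmarginal (fun _ => ν) V (fun σ => w V σ * f σ) η := by
  simp only [mul_comm (w V _) (avg _ _ _ _ _)]
  rw [lmarginal_mul_left V (hw.measurable V) (dependsOn_avg V f), avg,
    mul_right_comm, ENNReal.inv_mul_cancel (hw.ne_zero V η) (hw.ne_top V η), one_mul]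

/-- By `consistent`, the weights of `V'` and `V` differ by a factor that does not involve the spins
in `V`. Integrating over `V` first, this factor comes out, and what remains is unchanged when `f` is
replaced by its average in `V`. -/
lemma avg_avg [SigmaFinite ν] (hw : IsWeight ν w) {V V' : Finset I} (h : V ⊆ V')
    {f : (I → E) → ℝ≥0∞} (hf : Measurable f) (η : I → E) :
    avg ν w V' (avg ν w V f) η = avg ν w V' f η := by
  obtain ⟨u, hu, hud, huw⟩ := hw.consistent V V' h
  have hm := hw.measurable
  suffices lmarginal (fun _ => ν) V' (fun σ => w V' σ * avg ν w V f σ) η =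
      lmarginal (fun _ => ν) V' (fun σ => w V' σ * f σ) η from
    congrArg ((lmarginal (fun _ => ν) V' (w V') η)⁻¹ * ·) this
  rw [lmarginal_of_subset h (f := fun σ => w V' σ * avg ν w V f σ)
      ((hm V').mul (measurable_avg hw V hf)),
    lmarginal_of_subset h (f := fun σ => w V' σ * f σ) ((hm V').mul hf)]
  congr 1
  ext σ
  simp only [huw, mul_assoc]
  rw [lmarginal_mul_left V (f := fun σ => w V σ * avg ν w V f σ)
      ((hm V).mul (measurable_avg hw V hf)) hud,
    lmarginal_mul_left V (f := fun σ => w V σ * f σ) ((hm V).mul hf) hud]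
  congr 1
  exact lmarginal_weight_mul_avg hw V σ

lemma dlr_spec [SigmaFinite ν] (hw : IsWeight ν w) {V V' : Finset I} (h : V ⊆ V') (η : I → E) :
    DLR ν w V (spec ν w V' η) := fun f hf => by
  rw [lintegral_spec hw V' η hf, lintegral_spec hw V' η (measurable_avg hw V hf), avg_avg hw h hf]

lemma DLR.mono [SigmaFinite ν] (hw : IsWeight ν w) {V V' : Finset I} (h : V ⊆ V')
    {μ : Measure (I → E)} (hμ : DLR ν w V' μ) : DLR ν w V μ := fun f hf => by
  rw [← hμ f hf, ← hμ _ (measurable_avg hw V hf)]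
  simp only [avg_avg hw h hf]

lemma dlr_of_indicator [SigmaFinite ν] (hw : IsWeight ν w) {V : Finset I} {μ : Measure (I → E)}
    (h : ∀ B, MeasurableSet B → ∫⁻ η, spec ν w V η B ∂μ = μ B) : DLR ν w V μ := fun f hf => by
  have hk : Measurable (spec ν w V) := by
    refine Measure.measurable_of_measurable_coe _ fun B hB => ?_
    simp only [spec_apply hw V _ hB]
    exact measurable_avg hw V (measurable_one.indicator hB)
  have hb : μ.bind (spec ν w V) = μ := by
    ext B hB
    rw [Measure.bind_apply hB hk.aemeasurable, h B hB]
  conv_rhs => rw [← hb]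
  rw [Measure.lintegral_bind hk.aemeasurable hf.aemeasurable]
  simp only [lintegral_spec hw V _ hf]

lemma isGibbs_spec_iff [SigmaFinite ν] (hw : IsWeight ν w) {μ : Measure (I → E)} :
    IsGibbs (spec ν w) μ ↔ IsProbabilityMeasure μ ∧ ∀ V, DLR ν w V μ := by
  refine and_congr_right fun _ => forall_congr' fun V => ⟨dlr_of_indicator hw, fun h B hB => ?_⟩
  simp only [spec_apply hw V _ hB]
  rw [h _ (measurable_one.indicator hB), lintegral_indicator_one hB]

end Avg

end RotatorPCA

namespace RotatorPCA

open Function Filter Topology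

/-! ### Total variation and oscillation -/

section TotalVariation

variable {E : Type} [MeasurableSpace E]

/-- After subtracting the infimum over `A`, the function lies in `[0, D]` almost everywhere. On the
Hahn set where `P ≤ Q` the integral only grows; on its complement the excess `P - Q` has mass at
most `ε`. The constant is `D * ε` with no factor two, as Dobrushin's condition with the total
variation distance requires. -/
lemma lintegral_le_add_of_measure_le {P Q : Measure E} [IsProbabilityMeasure P]
    [IsProbabilityMeasure Q] {g : E → ℝ≥0∞} (hg : Measurable g) {A : Set E}
    (hP : ∀ᵐ x ∂P, x ∈ A) (hQ : ∀ᵐ x ∂Q, x ∈ A) {D ε : ℝ≥0∞}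
    (hosc : ∀ x ∈ A, ∀ y ∈ A, g x ≤ g y + D)
    (hPQ : ∀ B, MeasurableSet B → P B ≤ Q B + ε) :
    ∫⁻ x, g x ∂P ≤ ∫⁻ x, g x ∂Q + D * ε := by
  obtain ⟨s, hs⟩ := exists_isHahnDecomposition P Q
  set m : ℝ≥0∞ := ⨅ x ∈ A, g x with hm
  have hmle : ∀ x ∈ A, m ≤ g x := fun x hx => iInf₂_le x hx
  have hgm : ∀ x ∈ A, g x ≤ m + D := fun x hx => by
    have hA : Nonempty A := ⟨⟨x, hx⟩⟩
    rw [hm, ← iInf_subtype'', ENNReal.iInf_add]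
    exact le_iInf fun y => hosc x hx y y.2
  set h : E → ℝ≥0∞ := fun x => g x - m with hh
  have hhm : Measurable h := hg.sub_const m
  have hgh : ∀ R : Measure E, IsProbabilityMeasure R → (∀ᵐ x ∂ R, x ∈ A) →
      ∫⁻ x, g x ∂ R = m + (∫⁻ x, h x ∂ R) := fun R _ hR => by
    have : ∫⁻ x, g x ∂ R = ∫⁻ x, (m + h x) ∂ R := by
      refine lintegral_congr_ae ?_
      filter_upwards [hR] with x hx
      exact (add_tsub_cancel_of_le (hmle x hx)).symm
    rw [this, lintegral_add_left measurable_const, lintegral_const, measure_univ, mul_one]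
  by_cases hmt : m = ∞
  · rw [hgh Q inferInstance hQ, hmt]; simp
  have hhD : ∀ᵐ x ∂P, h x ≤ D := by
    filter_upwards [hP] with x hx
    exact tsub_le_iff_left.2 (hgm x hx)
  rw [hgh P inferInstance hP, hgh Q inferInstance hQ, add_assoc]
  gcongr
  rw [← lintegral_add_compl h hs.measurableSet (μ := P),
    ← lintegral_add_compl h hs.measurableSet (μ := Q), add_assoc]
  refine add_le_add (lintegral_mono' hs.le_on le_rfl) ?_
  have hR : ∫⁻ x in sᶜ, h x ∂P =
      ∫⁻ x, h x ∂(P.restrict sᶜ - Q.restrict sᶜ) + ∫⁻ x in sᶜ, h x ∂Q := by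
    rw [← lintegral_add_measure, Measure.sub_add_cancel_of_le hs.ge_on_compl]
  rw [hR, add_comm]
  gcongr
  have hRle : P.restrict sᶜ - Q.restrict sᶜ ≤ P := Measure.sub_le.trans Measure.restrict_le_self
  calc ∫⁻ x, h x ∂(P.restrict sᶜ - Q.restrict sᶜ)
      ≤ ∫⁻ _, D ∂(P.restrict sᶜ - Q.restrict sᶜ) :=
        lintegral_mono_ae (Measure.absolutelyContinuous_of_le hRle hhD)
    _ = D * (P sᶜ - Q sᶜ) := by
        rw [lintegral_const, Measure.sub_apply MeasurableSet.univ hs.ge_on_compl]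
        simp
    _ ≤ D * ε := by
        gcongr
        exact tsub_le_iff_left.2 (hPQ _ hs.measurableSet.compl)

/-- The multiplicative form of letting `ε` tend to zero; it fits quasilocality, which is expressed
through ratios. -/
lemma le_of_forall_one_lt_le_mul {a b : ℝ≥0∞} (h : ∀ c : ℝ≥0∞, 1 < c → c ≠ ∞ → a ≤ c * b) :
    a ≤ b := by
  by_cases hb : b = ∞
  · simp [hb]
  have hlim : Tendsto (fun c : ℝ≥0∞ => c * b) (𝓝[>] 1) (𝓝 (1 * b)) :=
    ENNReal.Tendsto.mul_const (tendsto_id.mono_left nhdsWithin_le_nhds) (Or.inl one_ne_zero)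
  rw [one_mul] at hlim
  have hne : (𝓝[>] (1 : ℝ≥0∞)).NeBot := nhdsGT_neBot_of_exists_gt ⟨2, by norm_num⟩
  refine ge_of_tendsto hlim ?_
  filter_upwards [Ioo_mem_nhdsGT ENNReal.one_lt_top] with c hc using h c hc.1 hc.2.ne

end TotalVariation

/-! ### Dobrushin's uniqueness theorem -/

section Dobrushin

variable {I E : Type} [MeasurableSpace E]

open Classical in
/-- On configurations with spins in `A`, the function `f` changes by at most `d j` for every
coordinate `j` that is changed. -/
def OscBound (A : I → Set E) (f : (I → E) → ℝ≥0∞) (d : I → ℝ≥0∞) : Prop :=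
  ∀ η η₂ : I → E, (∀ i, η i ∈ A i) → (∀ i, η₂ i ∈ A i) →
    f η ≤ f η₂ + ∑' j, if η j = η₂ j then 0 else d j

/-- Dobrushin's notion of an estimate for the distance of two measures. -/
def IsEstimate (A : I → Set E) (μ μ₂ : Measure (I → E)) (a : I → ℝ≥0∞) : Prop :=
  ∀ (f : (I → E) → ℝ≥0∞) (d : I → ℝ≥0∞), Measurable f → ∑' j, d j ≠ ∞ → OscBound A f d →
    ∫⁻ σ, f σ ∂μ ≤ ∫⁻ σ, f σ ∂μ₂ + ∑' j, a j * d j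

variable [DecidableEq I] {ν : Measure E} {w : Finset I → (I → E) → ℝ≥0∞} {A : I → Set E}

lemma avg_singleton_eq_lintegral (hw : IsWeight ν w) (i : I) (η : I → E) {f : (I → E) → ℝ≥0∞}
    (hf : Measurable f) :
    avg ν w {i} f η = ∫⁻ s, f (update η i s) ∂((spec ν w {i} η).map fun σ => σ i) := by
  have hfu : Measurable fun s => f (update η i s) := hf.comp (measurable_update η)
  rw [lintegral_map hfu (measurable_pi_apply i),
    lintegral_spec hw {i} η (f := fun σ => f (update η i (σ i))) (hfu.comp (measurable_pi_apply i))]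
  simp [avg, lmarginal_singleton]

/-- The law of the spin at `i` under the single-site specification depends on the boundary
condition at most through the interdependence coefficients. -/
lemma spec_singleton_le_add_tsum (C : I → I → ℝ≥0∞)
    (hC : ∀ (i j : I) (η η₂ : I → E), (∀ k, η k ∈ A k) → (∀ k, η₂ k ∈ A k) →
      (∀ k, k ≠ j → η k = η₂ k) → ∀ B, MeasurableSet B →
      spec ν w {i} η {σ | σ i ∈ B} ≤ spec ν w {i} η₂ {σ | σ i ∈ B} + C i j)
    (hQ : ∀ (i : I) (c : ℝ≥0∞), 1 < c → ∃ W : Finset I, ∀ η η₂ : I → E,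
      (∀ k ∈ W, η k = η₂ k) → ∀ B, MeasurableSet B →
      spec ν w {i} η {σ | σ i ∈ B} ≤ c * spec ν w {i} η₂ {σ | σ i ∈ B})
    (i : I) (η η₂ : I → E) (hη : ∀ k, η k ∈ A k) (hη₂ : ∀ k, η₂ k ∈ A k)
    (B : Set E) (hB : MeasurableSet B) :
    spec ν w {i} η {σ | σ i ∈ B} ≤ spec ν w {i} η₂ {σ | σ i ∈ B} +
      ∑' j, open Classical in if η j = η₂ j then 0 else C i j := by
  classical
  refine le_of_forall_one_lt_le_mul fun c hc _ => ?_
  obtain ⟨W, hW⟩ := hQ i c hc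
  have hpw : ∀ W : Finset I, (∀ k, W.piecewise η η₂ k ∈ A k) := fun W k => by
    by_cases hk : k ∈ W <;> simp [hk, hη, hη₂]
  -- The boundary spins are changed one at a time inside a finite set. The infinitely many others
  -- are then changed at once, at the price of the factor `c` from `hQ`.
  have key : ∀ W : Finset I, spec ν w {i} (W.piecewise η η₂) {σ | σ i ∈ B} ≤
      spec ν w {i} η₂ {σ | σ i ∈ B} + ∑ j ∈ W, if η j = η₂ j then 0 else C i j := by
    intro W
    induction W using Finset.induction_on with
    | empty => simp
    | insert j W hj ih =>
      rw [Finset.sum_insert hj]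
      by_cases hjj : η j = η₂ j
      · have : (insert j W).piecewise η η₂ = W.piecewise η η₂ := by
          rw [Finset.piecewise_insert]
          simp [hjj, hj]
        rw [this]
        simpa [hjj] using ih
      · refine (hC i j _ (W.piecewise η η₂) (hpw _) (hpw _) (fun k hk => ?_) B hB).trans ?_
        · by_cases hkW : k ∈ W <;> simp [hk, hkW]
        · simp only [hjj, if_false]
          rw [add_comm (C i j), ← add_assoc]
          gcongr
  refine (hW η (W.piecewise η η₂) (fun k hk => by simp [hk]) B hB).trans ?_
  gcongr
  exact (key W).trans (by gcongr; exact ENNReal.sum_le_tsum W)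

/-- Averaging over the spin at `i` removes the direct dependence on it. A boundary spin `j` now acts
in two ways: inside `f`, with the spin at `i` held fixed (`h1`), and through the law of the spin at
`i`, which moves by `C i j` in total variation while `f` varies by at most `d i` in that spin
(`h2`). -/
lemma OscBound.avg (hw : IsWeight ν w) (C : I → I → ℝ≥0∞)
    (hA : ∀ i η, ∀ᵐ σ ∂spec ν w {i} η, σ i ∈ A i) (hAm : ∀ i, MeasurableSet (A i))
    (hC : ∀ (i : I) (η η₂ : I → E), (∀ k, η k ∈ A k) → (∀ k, η₂ k ∈ A k) →
      ∀ B, MeasurableSet B → spec ν w {i} η {σ | σ i ∈ B} ≤ spec ν w {i} η₂ {σ | σ i ∈ B} +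
        ∑' j, open Classical in if η j = η₂ j then 0 else C i j)
    {f : (I → E) → ℝ≥0∞} (hf : Measurable f) {d : I → ℝ≥0∞}
    (h : OscBound A f d) (i : I) :
    OscBound A (avg ν w {i} f) (fun j => (if j = i then 0 else d j) + d i * C i j) := by
  classical
  intro η η₂ hη hη₂
  have hup : ∀ η : I → E, (∀ k, η k ∈ A k) → ∀ s ∈ A i, ∀ k, update η i s k ∈ A k := by
    intro η hη s hs k
    rcases eq_or_ne k i with rfl | hk
    · simpa using hs
    · simpa [hk] using hη k
  have := fun η => isProbabilityMeasure_spec hw {i} η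
  have hmi : Measurable fun σ : I → E => σ i := measurable_pi_apply i
  have := fun η => Measure.isProbabilityMeasure_map (μ := spec ν w {i} η) hmi.aemeasurable
  have hPA : ∀ η, ∀ᵐ s ∂(spec ν w {i} η).map fun σ => σ i, s ∈ A i := fun η =>
    (ae_map_iff hmi.aemeasurable (hAm i)).2 (hA i η)
  have h1 : ∀ s ∈ A i, f (update η i s) ≤ f (update η₂ i s) +
      ∑' j, if η j = η₂ j then 0 else (if j = i then 0 else d j) := by
    intro s hs
    refine (h _ _ (hup η hη s hs) (hup η₂ hη₂ s hs)).trans ?_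
    gcongr with j
    rcases eq_or_ne j i with rfl | hj <;> simp [*]
  have h2 : ∀ s ∈ A i, ∀ t ∈ A i, f (update η₂ i s) ≤ f (update η₂ i t) + d i := by
    intro s hs t ht
    refine (h _ _ (hup η₂ hη₂ s hs) (hup η₂ hη₂ t ht)).trans ?_
    gcongr
    rw [tsum_eq_single i]
    · split_ifs <;> simp
    · intro j hj; simp [hj]
  rw [avg_singleton_eq_lintegral hw i η hf, avg_singleton_eq_lintegral hw i η₂ hf]
  calc ∫⁻ s, f (update η i s) ∂((spec ν w {i} η).map fun σ => σ i)
      ≤ ∫⁻ s, (f (update η₂ i s) + ∑' j, if η j = η₂ j then 0 else (if j = i then 0 else d j))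
          ∂((spec ν w {i} η).map fun σ => σ i) := by
        refine lintegral_mono_ae ?_
        filter_upwards [hPA η] with s hs using h1 s hs
    _ = ∫⁻ s, f (update η₂ i s) ∂((spec ν w {i} η).map fun σ => σ i) +
          ∑' j, if η j = η₂ j then 0 else (if j = i then 0 else d j) := by
        rw [lintegral_add_right _ measurable_const]; simp
    _ ≤ (∫⁻ s, f (update η₂ i s) ∂((spec ν w {i} η₂).map fun σ => σ i) +
          d i * ∑' j, if η j = η₂ j then 0 else C i j) +
          ∑' j, if η j = η₂ j then 0 else (if j = i then 0 else d j) := by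
        gcongr
        refine lintegral_le_add_of_measure_le (hf.comp (measurable_update η₂)) (hPA η) (hPA η₂) h2
          fun B hB => ?_
        rw [Measure.map_apply hmi hB, Measure.map_apply hmi hB]
        exact hC i η η₂ hη hη₂ B hB
    _ = _ := by
        rw [add_assoc, ← ENNReal.tsum_mul_left, ← ENNReal.tsum_add]
        congr 2
        ext j
        by_cases h : η j = η₂ j <;> simp [h, add_comm]

lemma IsEstimate.mono {μ μ₂ : Measure (I → E)} {a b : I → ℝ≥0∞} (h : IsEstimate A μ μ₂ a)
    (hab : ∀ i, a i ≤ b i) : IsEstimate A μ μ₂ b := fun f d hf hd hfd =>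
  (h f d hf hd hfd).trans (by gcongr with j; exact hab j)

/-- The total oscillation of `f` on admissible configurations is at most `∑ d j`. This starts the
iteration. -/
lemma isEstimate_one [Countable I] {μ μ₂ : Measure (I → E)} [IsProbabilityMeasure μ]
    [IsProbabilityMeasure μ₂] (hμ : ∀ᵐ σ ∂μ, ∀ i, σ i ∈ A i) (hμ₂ : ∀ᵐ σ ∂μ₂, ∀ i, σ i ∈ A i) :
    IsEstimate A μ μ₂ 1 := by
  intro f d hf _ hfd
  have h : ∀ η η₂ : I → E, (∀ i, η i ∈ A i) → (∀ i, η₂ i ∈ A i) → f η ≤ f η₂ + ∑' j, d j := by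
    intro η η₂ hη hη₂
    refine (hfd η η₂ hη hη₂).trans ?_
    gcongr with j
    split_ifs <;> simp
  have h' : ∀ η₂ : I → E, (∀ i, η₂ i ∈ A i) → ∫⁻ σ, f σ ∂μ ≤ f η₂ + ∑' j, d j := by
    intro η₂ hη₂
    calc ∫⁻ σ, f σ ∂μ ≤ ∫⁻ _, (f η₂ + ∑' j, d j) ∂μ := by
          refine lintegral_mono_ae ?_
          filter_upwards [hμ] with η hη using h η η₂ hη hη₂
      _ = _ := by simp
  calc ∫⁻ σ, f σ ∂μ = ∫⁻ _, ∫⁻ σ, f σ ∂μ ∂μ₂ := by simp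
    _ ≤ ∫⁻ σ, (f σ + ∑' j, d j) ∂μ₂ := by
        refine lintegral_mono_ae ?_
        filter_upwards [hμ₂] with η hη using h' η hη
    _ = _ := by rw [lintegral_add_right _ measurable_const]; simp

/-- Both measures satisfy the DLR equation at `i`, so `f` may be replaced by its average at `i`
before the old estimate is applied. The oscillations of the average are those in `hosc`; collecting
the terms that contain `d i` yields the new coefficient. -/
lemma IsEstimate.update [SigmaFinite ν] (hw : IsWeight ν w) {C : I → I → ℝ≥0∞} {c : ℝ≥0∞}
    (hc : c ≤ 1) (hCc : ∀ i, ∑' j, C i j ≤ c)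
    (hosc : ∀ (f : (I → E) → ℝ≥0∞) (d : I → ℝ≥0∞), Measurable f → OscBound A f d → ∀ i,
      OscBound A (avg ν w {i} f) (fun j => (if j = i then 0 else d j) + d i * C i j))
    {μ μ₂ : Measure (I → E)} (hμ : ∀ V, DLR ν w V μ) (hμ₂ : ∀ V, DLR ν w V μ₂)
    {a : I → ℝ≥0∞} (ha : IsEstimate A μ μ₂ a) (i : I) :
    IsEstimate A μ μ₂ (Function.update a i (∑' j, C i j * a j)) := by
  intro f d hf hd hfd
  have hd' : ∑' j, ((if j = i then 0 else d j) + d i * C i j) ≠ ∞ := by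
    rw [ENNReal.tsum_add, ENNReal.tsum_mul_left]
    refine ENNReal.add_ne_top.2 ⟨ne_top_of_le_ne_top hd ?_, ENNReal.mul_ne_top
      (ENNReal.ne_top_of_tsum_ne_top hd i)
      (ne_top_of_le_ne_top ENNReal.one_ne_top ((hCc i).trans hc))⟩
    gcongr with j
    split_ifs <;> simp
  have := ha _ _ (measurable_avg hw {i} hf) hd' (hosc f d hf hfd i)
  rw [hμ {i} f hf, hμ₂ {i} f hf] at this
  refine this.trans_eq ?_
  congr 1
  have : ∀ j, Function.update a i (∑' j, C i j * a j) j * d j =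
      a j * (if j = i then 0 else d j) + if j = i then (∑' j, C i j * a j) * d i else 0 := by
    intro j
    rcases eq_or_ne j i with rfl | hj <;> simp [*]
  simp only [this, mul_add]
  rw [ENNReal.tsum_add, ENNReal.tsum_add, tsum_ite_eq, ← ENNReal.tsum_mul_right]
  congr 2
  ext j
  ring

/-- Updating the sites of a finite set in turn lowers the estimate there to `c * t` and leaves `t`
elsewhere. As the set exhausts `I`, the leftover `t * ∑_{j ∉ V} d j` is the tail of a convergent
sum. -/
lemma IsEstimate.const_mul [Countable I] [SigmaFinite ν] (hw : IsWeight ν w)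
    {C : I → I → ℝ≥0∞} {c : ℝ≥0∞} (hc : c ≤ 1) (hCc : ∀ i, ∑' j, C i j ≤ c)
    (hosc : ∀ (f : (I → E) → ℝ≥0∞) (d : I → ℝ≥0∞), Measurable f → OscBound A f d → ∀ i,
      OscBound A (avg ν w {i} f) (fun j => (if j = i then 0 else d j) + d i * C i j))
    {μ μ₂ : Measure (I → E)} (hμ : ∀ V, DLR ν w V μ) (hμ₂ : ∀ V, DLR ν w V μ₂)
    {t : ℝ≥0∞} (ht : t ≠ ∞) (ha : IsEstimate A μ μ₂ fun _ => t) :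
    IsEstimate A μ μ₂ fun _ => c * t := by
  have hct : c * t ≤ t := by simpa using mul_le_mul_left hc t
  have key : ∀ V : Finset I, IsEstimate A μ μ₂ fun j => if j ∈ V then c * t else t := by
    intro V
    induction V using Finset.induction_on with
    | empty => simpa using ha
    | insert i V hi ih =>
      refine (IsEstimate.update hw hc hCc hosc hμ hμ₂ ih i).mono fun j => ?_
      rcases eq_or_ne j i with rfl | hj
      · simp only [update_self, Finset.mem_insert_self, if_true]
        calc ∑' k, C j k * (if k ∈ V then c * t else t) ≤ ∑' k, C j k * t := by
              gcongr with k
              split_ifs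
              · exact hct
              · exact le_rfl
          _ ≤ c * t := by rw [ENNReal.tsum_mul_right]; gcongr; exact hCc j
      · simp [hj]
  intro f d hf hd hfd
  have hlim : Tendsto (fun V : Finset I => ∫⁻ σ, f σ ∂μ₂ + (∑' j, c * t * d j +
      t * ∑' j : {j // j ∉ V}, d j)) atTop (𝓝 (∫⁻ σ, f σ ∂μ₂ + (∑' j, c * t * d j + t * 0))) :=
    tendsto_const_nhds.add (tendsto_const_nhds.add
      (ENNReal.Tendsto.const_mul (ENNReal.tendsto_tsum_compl_atTop_zero hd) (Or.inr ht)))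
  rw [mul_zero, add_zero] at hlim
  refine ge_of_tendsto' hlim fun V => (key V f d hf hd hfd).trans ?_
  gcongr
  rw [← ENNReal.tsum_mul_left]
  have : ∀ j, (if j ∈ V then c * t else t) * d j ≤
      c * t * d j + ({j | j ∉ V} : Set I).indicator (fun j => t * d j) j := by
    intro j
    by_cases hj : j ∈ V <;> simp [hj]
  refine (ENNReal.tsum_le_tsum this).trans_eq ?_
  rw [ENNReal.tsum_add, ← tsum_subtype {j | j ∉ V} (fun j => t * d j)]
  rfl

/-- Dobrushin's uniqueness theorem. -/
theorem eq_of_dobrushin [Countable I] [SigmaFinite ν] (hw : IsWeight ν w)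
    (C : I → I → ℝ≥0∞) {c : ℝ≥0∞} (hc : c < 1) (hCc : ∀ i, ∑' j, C i j ≤ c)
    (hA : ∀ i η, ∀ᵐ σ ∂spec ν w {i} η, σ i ∈ A i) (hAm : ∀ i, MeasurableSet (A i))
    (hC : ∀ (i j : I) (η η₂ : I → E), (∀ k, η k ∈ A k) → (∀ k, η₂ k ∈ A k) →
      (∀ k, k ≠ j → η k = η₂ k) → ∀ B, MeasurableSet B →
      spec ν w {i} η {σ | σ i ∈ B} ≤ spec ν w {i} η₂ {σ | σ i ∈ B} + C i j)
    (hQ : ∀ (i : I) (c : ℝ≥0∞), 1 < c → ∃ W : Finset I, ∀ η η₂ : I → E,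
      (∀ k ∈ W, η k = η₂ k) → ∀ B, MeasurableSet B →
      spec ν w {i} η {σ | σ i ∈ B} ≤ c * spec ν w {i} η₂ {σ | σ i ∈ B})
    {μ μ₂ : Measure (I → E)} (hμ : IsGibbs (spec ν w) μ) (hμ₂ : IsGibbs (spec ν w) μ₂) :
    μ = μ₂ := by
  -- The single-site kernels charge only `A i`, and the DLR equation at `{i}` passes this on to
  -- every Gibbs measure.
  have hsupp : ∀ ρ : Measure (I → E), IsGibbs (spec ν w) ρ → ∀ᵐ σ ∂ρ, ∀ i, σ i ∈ A i := by
    intro ρ hρ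
    refine ae_all_iff.2 fun i => ?_
    have hm : MeasurableSet {σ : I → E | σ i ∈ A i} := measurable_pi_apply i (hAm i)
    have := hρ.2 {i} _ hm.compl
    rw [ae_iff, ← Set.compl_ofPred, ← this]
    exact (lintegral_congr fun η => (ae_iff.1 (hA i η))).trans lintegral_zero
  have hle : ∀ ρ ρ₂ : Measure (I → E), IsGibbs (spec ν w) ρ → IsGibbs (spec ν w) ρ₂ →
      ∀ (f : (I → E) → ℝ≥0∞) (d : I → ℝ≥0∞), Measurable f → ∑' j, d j ≠ ∞ → OscBound A f d →
      ∫⁻ σ, f σ ∂ρ ≤ ∫⁻ σ, f σ ∂ρ₂ := by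
    intro ρ ρ₂ hρ hρ₂ f d hf hd hfd
    have := hρ.1
    have := hρ₂.1
    have hest : ∀ n : ℕ, IsEstimate A ρ ρ₂ fun _ => c ^ n := by
      intro n
      induction n with
      | zero => simpa using! isEstimate_one (hsupp ρ hρ) (hsupp ρ₂ hρ₂)
      | succ n ih =>
        simp only [pow_succ']
        exact IsEstimate.const_mul hw hc.le hCc (fun f d hf h i => h.avg hw C hA hAm
          (spec_singleton_le_add_tsum C hC hQ) hf i)
          ((isGibbs_spec_iff hw).1 hρ).2 ((isGibbs_spec_iff hw).1 hρ₂).2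
          (ENNReal.pow_ne_top (hc.trans_le le_top).ne) ih
    have hlim : Tendsto (fun n : ℕ => ∫⁻ σ, f σ ∂ρ₂ + c ^ n * ∑' j, d j) atTop
        (𝓝 (∫⁻ σ, f σ ∂ρ₂ + 0 * ∑' j, d j)) :=
      tendsto_const_nhds.add (ENNReal.Tendsto.mul_const
        (ENNReal.tendsto_pow_atTop_nhds_zero_of_lt_one hc) (Or.inr hd))
    rw [zero_mul, add_zero] at hlim
    refine ge_of_tendsto' hlim fun n => (hest n f d hf hd hfd).trans_eq ?_
    rw [ENNReal.tsum_mul_left]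
  have hcyl : ∀ ρ ρ₂ : Measure (I → E), IsGibbs (spec ν w) ρ → IsGibbs (spec ν w) ρ₂ →
      ∀ B ∈ measurableCylinders (fun _ : I => E), ρ B ≤ ρ₂ B := by
    intro ρ ρ₂ hρ hρ₂ B hB
    have hBm : MeasurableSet B := MeasurableSet.of_mem_measurableCylinders hB
    obtain ⟨V, S, hS, rfl⟩ := (mem_measurableCylinders _).1 hB
    -- An event in `V` oscillates by at most one at each site of `V` and not at all elsewhere, so
    -- its oscillations are summable.
    have := hle ρ ρ₂ hρ hρ₂ ((cylinder V S).indicator 1) (fun j => if j ∈ V then 1 else 0)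
      (measurable_one.indicator hBm) ?_ ?_
    · rwa [lintegral_indicator_one hBm, lintegral_indicator_one hBm] at this
    · rw [tsum_eq_sum (s := V) (fun j hj => by simp [hj])]
      simp
    · intro η η₂ _ _
      by_cases h : ∀ j ∈ V, η j = η₂ j
      · have : V.restrict η = V.restrict η₂ := funext fun j => h j j.2
        refine le_add_right (le_of_eq ?_)
        exact indicator_one_congr (by rw [mem_cylinder, mem_cylinder, this])
      · push Not at h
        obtain ⟨j, hj, hne⟩ := h
        refine le_add_left (le_trans ?_ (ENNReal.le_tsum j))
        simp only [hne, hj, if_true, if_false]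
        exact Set.indicator_le_self' (fun _ _ => zero_le) _
  have := hμ.1
  have := hμ₂.1
  refine ext_of_generate_finite _ generateFrom_measurableCylinders.symm
    isPiSystem_measurableCylinders (fun B hB => ?_) (by simp)
  exact le_antisymm (hcyl μ μ₂ hμ hμ₂ B hB) (hcyl μ₂ μ hμ₂ hμ B hB)

end Dobrushin

end RotatorPCA

namespace RotatorPCA

open Function Filter Topology

/-! ### Passing to the limit beyond weak convergence -/

section Limits

/-- A discretized layer-cake formula: up to an error `1 / M`, `F` is an average of indicators of
finitely many superlevel sets, and for these convergence is assumed. -/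
lemma limsup_lintegral_le_of_tendsto_measure {X ι : Type*} [MeasurableSpace X] {U : Filter ι}
    [U.NeBot] {m : ι → Measure X} {μ : Measure X} [IsProbabilityMeasure μ]
    {F : X → ℝ≥0∞} (hF : Measurable F) (hF1 : ∀ x, F x ≤ 1)
    (h : ∀ t, Tendsto (fun n => m n {x | t < F x}) U (𝓝 (μ {x | t < F x}))) :
    limsup (fun n => ∫⁻ x, F x ∂m n) U ≤ ∫⁻ x, F x ∂μ := by
  have key : ∀ N : ℕ, limsup (fun n => ∫⁻ x, F x ∂m n) U ≤
      ∫⁻ x, F x ∂μ + ((N + 1 : ℕ) : ℝ≥0∞)⁻¹ := by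
    intro N
    set M : ℝ≥0∞ := ((N + 1 : ℕ) : ℝ≥0∞) with hM
    have hM0 : M ≠ 0 := by simp [hM]
    have hMt : M ≠ ∞ := by simp [hM]
    set A : ℕ → Set X := fun k => {x | (k : ℝ≥0∞) / M < F x} with hA
    have hAm : ∀ k, MeasurableSet (A k) := fun k => measurableSet_lt measurable_const hF
    -- The number of levels `k / M` strictly below `F x` is the ceiling of `M * F x`. There are `N +
    -- 1 = M` levels because `F ≤ 1`.
    have hsum : ∀ x, ∃ j : ℕ, ∑ k ∈ Finset.range (N + 1), (A k).indicator (1 : X → ℝ≥0∞) x = j ∧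
        M * F x ≤ j ∧ (j : ℝ≥0∞) ≤ M * F x + 1 := by
      intro x
      have hFt : M * F x ≠ ∞ := ENNReal.mul_ne_top hMt (ne_top_of_le_ne_top ENNReal.one_ne_top (hF1 x))
      set r : ℝ := (M * F x).toReal with hr
      have hrE : M * F x = ENNReal.ofReal r := (ENNReal.ofReal_toReal hFt).symm
      have hr0 : 0 ≤ r := ENNReal.toReal_nonneg
      have hrN : r ≤ (N + 1 : ℕ) := by
        have : M * F x ≤ M := by simpa using mul_le_mul_right (hF1 x) M
        have := ENNReal.toReal_mono hMt this
        rwa [← hr, hM, ENNReal.toReal_natCast] at this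
      refine ⟨⌈r⌉₊, ?_, ?_, ?_⟩
      · have hmem : ∀ k : ℕ, x ∈ A k ↔ k < ⌈r⌉₊ := by
          intro k
          rw [Nat.lt_ceil, hA, Set.mem_ofPred_eq, ENNReal.div_lt_iff (Or.inl hM0) (Or.inl hMt),
            mul_comm, hrE, ← ENNReal.ofReal_natCast, ENNReal.ofReal_lt_ofReal_iff_of_nonneg
            (Nat.cast_nonneg k)]
        classical
        simp only [Set.indicator_apply, hmem, Pi.one_apply, Finset.sum_boole]
        congr 1
        have : (Finset.range (N + 1)).filter (fun k => k < ⌈r⌉₊) = Finset.range ⌈r⌉₊ := by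
          ext k
          have := Nat.ceil_le.2 hrN
          simp only [Finset.mem_filter, Finset.mem_range]
          omega
        rw [this, Finset.card_range]
      · rw [hrE, ← ENNReal.ofReal_natCast]
        exact ENNReal.ofReal_le_ofReal (Nat.le_ceil r)
      · rw [hrE, ← ENNReal.ofReal_natCast, ← ENNReal.ofReal_one, ← ENNReal.ofReal_add hr0 zero_le_one]
        exact ENNReal.ofReal_le_ofReal (Nat.ceil_lt_add_one hr0).le
    have hint : ∀ R : Measure X,
        ∫⁻ x, M⁻¹ * ∑ k ∈ Finset.range (N + 1), (A k).indicator (1 : X → ℝ≥0∞) x ∂ R =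
        M⁻¹ * ∑ k ∈ Finset.range (N + 1), R (A k) := by
      intro R
      rw [lintegral_const_mul _ (Finset.measurable_sum _ fun k _ => measurable_one.indicator (hAm k)),
        lintegral_finsetSum _ fun k _ => measurable_one.indicator (hAm k)]
      simp only [lintegral_indicator_one (hAm _)]
    have hle : ∀ R : Measure X, ∫⁻ x, F x ∂ R ≤ M⁻¹ * ∑ k ∈ Finset.range (N + 1), R (A k) := by
      intro R
      rw [← hint R]
      refine lintegral_mono fun x => ?_
      obtain ⟨j, hj, h1, -⟩ := hsum x
      rw [hj]
      rw [← ENNReal.div_eq_inv_mul]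
      exact (ENNReal.le_div_iff_mul_le (Or.inl hM0) (Or.inl hMt)).2 (by rwa [mul_comm])
    have hge : M⁻¹ * ∑ k ∈ Finset.range (N + 1), μ (A k) ≤ ∫⁻ x, F x ∂μ + M⁻¹ := by
      have : ∫⁻ x, F x ∂μ + M⁻¹ = ∫⁻ x, (F x + M⁻¹) ∂μ := by
        rw [lintegral_add_right _ measurable_const]; simp
      rw [this, ← hint μ]
      refine lintegral_mono fun x => ?_
      obtain ⟨j, hj, -, h2⟩ := hsum x
      simp only [hj]
      calc M⁻¹ * j ≤ M⁻¹ * (M * F x + 1) := by gcongr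
        _ = F x + M⁻¹ := by
          rw [mul_add, ← mul_assoc, ENNReal.inv_mul_cancel hM0 hMt, one_mul, mul_one]
    have hlim : Tendsto (fun n => M⁻¹ * ∑ k ∈ Finset.range (N + 1), m n (A k)) U
        (𝓝 (M⁻¹ * ∑ k ∈ Finset.range (N + 1), μ (A k))) :=
      ENNReal.Tendsto.const_mul (tendsto_finsetSum _ fun k _ => h _) (Or.inr (by simp [hM0]))
    exact (limsup_le_limsup (Eventually.of_forall fun n => hle (m n))).trans
      (hlim.limsup_eq.trans_le hge)
  have hlim : Tendsto (fun N : ℕ => ∫⁻ x, F x ∂μ + ((N + 1 : ℕ) : ℝ≥0∞)⁻¹) atTop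
      (𝓝 (∫⁻ x, F x ∂μ + 0)) :=
    tendsto_const_nhds.add (ENNReal.tendsto_inv_nat_nhds_zero.comp (tendsto_add_atTop_nat 1))
  rw [add_zero] at hlim
  exact ge_of_tendsto' hlim key

variable {I E : Type} [Countable I] [MeasurableSpace E] [TopologicalSpace E] [CompactSpace E]
  [TopologicalSpace.MetrizableSpace E] [BorelSpace E] [SecondCountableTopology E]

/-- Weak convergence alone controls closed sets only from above. Domination by one finite measure
`R` extends this to every measurable base: approximate `S` from inside by a closed `K` with `R (S \
K)` small. The lower bound follows from the same estimate for the complement. -/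
lemma tendsto_measure_cylinder {ι : Type*} {U : Filter ι}
    {m : ι → ProbabilityMeasure (I → E)} {μ : ProbabilityMeasure (I → E)}
    (hlim : Tendsto m U (𝓝 μ)) (V : Finset I) (R : Measure (V → E)) [IsFiniteMeasure R]
    (hdom : ∀ᶠ n in U, ∀ S, MeasurableSet S →
      (m n : Measure (I → E)) (cylinder V S) ≤ R S)
    {S : Set (V → E)} (hS : MeasurableSet S) :
    Tendsto (fun n => (m n : Measure (I → E)) (cylinder V S)) U
      (𝓝 ((μ : Measure (I → E)) (cylinder V S))) := by
  have key : ∀ S : Set (V → E), MeasurableSet S → ∀ ε : ℝ≥0∞, 0 < ε → ∀ᶠ n in U,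
      (m n : Measure (I → E)) (cylinder V S) ≤ (μ : Measure (I → E)) (cylinder V S) + ε := by
    intro S hS ε hε
    have hε2 : ε / 2 ≠ 0 := (ENNReal.half_pos hε.ne').ne'
    obtain ⟨K, hKS, hK, hKε⟩ := hS.exists_isClosed_sdiff_lt (μ := R) (measure_ne_top R S) hε2
    have hKc : IsClosed (cylinder V K : Set (I → E)) :=
      hK.preimage (continuous_pi fun i => continuous_apply _)
    have hev : ∀ᶠ n in U, (m n : Measure (I → E)) (cylinder V K) <
        (μ : Measure (I → E)) (cylinder V K) + ε / 2 := by
      rcases U.eq_or_neBot with rfl | hU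
      · simp
      have hls := ProbabilityMeasure.limsup_measure_closed_le_of_tendsto hlim hKc
      exact eventually_lt_of_limsup_lt
        (hls.trans_lt (ENNReal.lt_add_right (measure_ne_top _ _) hε2))
    filter_upwards [hdom, hev] with n hn1 hn2
    have hsub : (cylinder V S : Set (I → E)) ⊆ cylinder V K ∪ cylinder V (S \ K) := by
      intro σ hσ
      by_cases h : V.restrict σ ∈ K
      · exact Or.inl h
      · exact Or.inr ⟨hσ, h⟩
    calc (m n : Measure (I → E)) (cylinder V S)
        ≤ (m n : Measure (I → E)) (cylinder V K) + (m n : Measure (I → E)) (cylinder V (S \ K)) :=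
          (measure_mono hsub).trans (measure_union_le _ _)
      _ ≤ ((μ : Measure (I → E)) (cylinder V K) + ε / 2) + ε / 2 :=
          add_le_add hn2.le ((hn1 _ (hS.diff hK.measurableSet)).trans hKε.le)
      _ ≤ _ := by
          rw [add_assoc, ENNReal.add_halves]
          gcongr
          exact Set.preimage_mono hKS
  refine (ENNReal.tendsto_nhds (measure_ne_top _ _)).2 fun ε hε => ?_
  filter_upwards [key S hS ε hε, key Sᶜ hS.compl ε hε] with n h1 h2
  refine ⟨?_, h1⟩
  rw [tsub_le_iff_right]
  have hm : MeasurableSet (cylinder V S : Set (I → E)) := hS.cylinder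
  rw [← compl_cylinder] at h2
  have e1 := measure_add_measure_compl (μ := (μ : Measure (I → E))) hm
  have e2 := measure_add_measure_compl (μ := (m n : Measure (I → E))) hm
  rw [measure_univ] at e1 e2
  have : (μ : Measure (I → E)) (cylinder V S) + (m n : Measure (I → E)) (cylinder V S)ᶜ ≤
      ((m n : Measure (I → E)) (cylinder V S) + ε) + (m n : Measure (I → E)) (cylinder V S)ᶜ := by
    calc _ ≤ (μ : Measure (I → E)) (cylinder V S) +
          ((μ : Measure (I → E)) (cylinder V S)ᶜ + ε) := by gcongr
      _ = (m n : Measure (I → E)) (cylinder V S) + (m n : Measure (I → E)) (cylinder V S)ᶜ + ε := by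
          rw [← add_assoc, e1, e2]
      _ = _ := by ring
  exact (ENNReal.add_le_add_iff_right (measure_ne_top _ _)).1 this

end Limits

/-! ### Quasilocality and bounded densities -/

section QuasiLocal

variable {I E : Type} [DecidableEq I] [MeasurableSpace E] {ν : Measure E}
  {w : Finset I → (I → E) → ℝ≥0∞}

/-- The weights depend little on far away spins. -/
def QuasiLocal (w : Finset I → (I → E) → ℝ≥0∞) : Prop :=
  ∀ (V : Finset I) (c : ℝ≥0∞), 1 < c → ∃ W : Finset I, ∀ σ σ' : I → E,
    (∀ i ∈ W, σ i = σ' i) → w V σ ≤ c * w V σ'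

/-- The finite-volume densities are bounded. -/
def BoundedDensity (ν : Measure E) (w : Finset I → (I → E) → ℝ≥0∞) : Prop :=
  ∀ V : Finset I, ∃ C : ℝ≥0∞, C ≠ ∞ ∧ ∀ σ, w V σ ≤ C * lmarginal (fun _ => ν) V (w V) σ

/-- The weight enters both the numerator and the normalization, and each costs a factor `√c`. The
function must be local within `W'`, since the boundary condition enters it too. -/
lemma QuasiLocal.avg_le (hw : IsWeight ν w) (hQ : QuasiLocal w) (V : Finset I) {c : ℝ≥0∞}
    (hc : 1 < c) : ∃ W : Finset I, ∀ W' : Finset I, W ⊆ W' → ∀ f : (I → E) → ℝ≥0∞, Measurable f →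
      DependsOn f (W' : Set I) → ∀ η η₂ : I → E, (∀ i ∈ W', η i = η₂ i) →
      avg ν w V f η ≤ c * avg ν w V f η₂ := by
  set b : ℝ≥0∞ := c ^ (1 / 2 : ℝ) with hb
  have hb1 : 1 < b := ENNReal.one_lt_rpow hc (by norm_num)
  have hbb : b * b = c := by
    rw [hb, ← ENNReal.rpow_add_of_nonneg _ _ (by norm_num) (by norm_num)]
    norm_num
  obtain ⟨W, hW⟩ := hQ V b hb1
  refine ⟨W, fun W' hWW' f hf hfd η η₂ h => ?_⟩
  have hup : ∀ (y : V → E), ∀ i ∈ W', updateFinset η V y i = updateFinset η₂ V y i := by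
    intro y i hi
    by_cases hiV : i ∈ V <;> simp [updateFinset, hiV, h i hi]
  have hmeas : ∀ η : I → E, Measurable fun y : V → E => w V (updateFinset η V y) := fun η =>
    (hw.measurable V).comp measurable_updateFinset
  have h1 : lmarginal (fun _ => ν) V (fun σ => w V σ * f σ) η ≤
      b * lmarginal (fun _ => ν) V (fun σ => w V σ * f σ) η₂ := by
    simp only [lmarginal]
    rw [← lintegral_const_mul _ (f := fun y => w V (updateFinset η₂ V y) * f (updateFinset η₂ V y))
      ((hmeas η₂).mul (hf.comp measurable_updateFinset))]
    refine lintegral_mono fun y => ?_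
    dsimp only
    rw [hfd (fun i hi => hup y i (by simpa using hi)), ← mul_assoc]
    gcongr
    exact hW _ _ fun i hi => hup y i (hWW' hi)
  have h2 : lmarginal (fun _ => ν) V (w V) η₂ ≤ b * lmarginal (fun _ => ν) V (w V) η := by
    simp only [lmarginal]
    rw [← lintegral_const_mul _ (hmeas η)]
    exact lintegral_mono fun y => hW _ _ fun i hi => (hup y i (hWW' hi)).symm
  have h3 : (lmarginal (fun _ => ν) V (w V) η)⁻¹ ≤ b * (lmarginal (fun _ => ν) V (w V) η₂)⁻¹ := by
    rw [← div_eq_mul_inv, ENNReal.le_div_iff_mul_le (Or.inl (hw.ne_zero V η₂))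
      (Or.inl (hw.ne_top V η₂)), mul_comm, ← div_eq_mul_inv]
    exact ENNReal.div_le_of_le_mul h2
  calc avg ν w V f η ≤ (b * (lmarginal (fun _ => ν) V (w V) η₂)⁻¹) *
        (b * lmarginal (fun _ => ν) V (fun σ => w V σ * f σ) η₂) := mul_le_mul' h3 h1
    _ = c * avg ν w V f η₂ := by rw [← hbb, avg]; ring

lemma QuasiLocal.spec_singleton_le (hw : IsWeight ν w) (hQ : QuasiLocal w)
    (i : I) (c : ℝ≥0∞) (hc : 1 < c) : ∃ W : Finset I, ∀ η η₂ : I → E,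
      (∀ k ∈ W, η k = η₂ k) → ∀ B, MeasurableSet B →
      spec ν w {i} η {σ | σ i ∈ B} ≤ c * spec ν w {i} η₂ {σ | σ i ∈ B} := by
  obtain ⟨W, hW⟩ := hQ.avg_le hw {i} hc
  refine ⟨insert i W, fun η η₂ h B hB => ?_⟩
  have hm : MeasurableSet {σ : I → E | σ i ∈ B} := measurable_pi_apply i hB
  rw [spec_apply hw _ _ hm, spec_apply hw _ _ hm]
  refine hW _ (Finset.subset_insert i W) _ (measurable_one.indicator hm) ?_ η η₂ h
  intro σ σ' hσ
  have : σ i = σ' i := hσ i (by simp)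
  exact indicator_one_congr (by simp [this])

lemma avg_cylinder_le {V : Finset I} (hw : IsWeight ν w) {C : ℝ≥0∞}
    (hC : ∀ σ, w V σ ≤ C * lmarginal (fun _ => ν) V (w V) σ) {S : Set (V → E)}
    (hS : MeasurableSet S) (η : I → E) :
    avg ν w V ((cylinder V S).indicator 1) η ≤ C * Measure.pi (fun _ : V => ν) S := by
  set Z := lmarginal (fun _ => ν) V (w V) η with hZ
  have : lmarginal (fun _ => ν) V (fun σ => w V σ * (cylinder V S).indicator 1 σ) η ≤
      (C * Z) * Measure.pi (fun _ : V => ν) S := by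
    rw [lmarginal, ← lintegral_indicator_one hS, ← lintegral_const_mul _ (measurable_one.indicator hS)]
    refine lintegral_mono fun y => mul_le_mul' ((hC _).trans_eq ?_) (le_of_eq ?_)
    · rw [hZ, dependsOn_updateFinset (dependsOn_lmarginal V (w V))]
    · have : V.restrict (updateFinset η V y) = y := by
        ext j; simp [updateFinset, Finset.restrict]
      exact indicator_one_congr (by rw [mem_cylinder, this])
  calc avg ν w V ((cylinder V S).indicator 1) η ≤ Z⁻¹ * ((C * Z) * Measure.pi (fun _ : V => ν) S) := by
        unfold avg; gcongr
    _ = (Z⁻¹ * Z) * (C * Measure.pi (fun _ : V => ν) S) := by ring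
    _ = _ := by rw [ENNReal.inv_mul_cancel (hw.ne_zero V η) (hw.ne_top V η), one_mul]

end QuasiLocal

/-! ### Existence of Gibbs measures and convergence of finite-volume distributions -/

section Existence

variable {I E : Type} [DecidableEq I] [Countable I] [MeasurableSpace E] [TopologicalSpace E]
  [CompactSpace E] [TopologicalSpace.MetrizableSpace E] [BorelSpace E] [SecondCountableTopology E]
  {ν : Measure E} [IsFiniteMeasure ν] {w : Finset I → (I → E) → ℝ≥0∞}

/-- Once the DLR equation in `V` holds, the bounded density dominates all the measures on
`V`-cylinders by the same multiple of the a-priori product measure. -/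
lemma tendsto_cylinder_of_dlr (hw : IsWeight ν w) (hb : BoundedDensity ν w) {ι : Type*}
    {U : Filter ι} {m : ι → ProbabilityMeasure (I → E)} {μ : ProbabilityMeasure (I → E)}
    (hlim : Tendsto m U (𝓝 μ)) (hm : ∀ V, ∀ᶠ n in U, DLR ν w V (m n))
    {B : Set (I → E)} (hB : B ∈ measurableCylinders fun _ : I => E) :
    Tendsto (fun n => (m n : Measure (I → E)) B) U (𝓝 ((μ : Measure (I → E)) B)) := by
  obtain ⟨V, S, hS, rfl⟩ := (mem_measurableCylinders _).1 hB
  obtain ⟨C, hC, hwC⟩ := hb V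
  lift C to NNReal using hC
  refine tendsto_measure_cylinder hlim V (C • Measure.pi fun _ : V => ν) ?_ hS
  filter_upwards [hm V] with n hn S hS
  have hcm : MeasurableSet (cylinder V S : Set (I → E)) := hS.cylinder
  rw [← lintegral_indicator_one hcm, ← hn _ (measurable_one.indicator hcm)]
  calc ∫⁻ σ, avg ν w V ((cylinder V S).indicator 1) σ ∂(m n : Measure (I → E))
      ≤ ∫⁻ _, C * Measure.pi (fun _ : V => ν) S ∂(m n : Measure (I → E)) :=
        lintegral_mono fun η => avg_cylinder_le hw hwC hS η
    _ = _ := by simp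

/-- The conditional probability `F` of a cylinder event need be neither continuous nor local.
Quasilocality traps it, up to a factor `c` close to one, against a local function `G`, whose
superlevel sets are cylinders and so converge in measure. This gives one inequality of the DLR
equation for each cylinder event. -/
lemma isGibbs_of_tendsto (hw : IsWeight ν w) (hb : BoundedDensity ν w) (hQ : QuasiLocal w)
    {ι : Type*} {U : Filter ι} [U.NeBot] {m : ι → ProbabilityMeasure (I → E)}
    {μ : ProbabilityMeasure (I → E)} (hlim : Tendsto m U (𝓝 μ))
    (hm : ∀ V, ∀ᶠ n in U, DLR ν w V (m n)) : IsGibbs (spec ν w) (μ : Measure (I → E)) := by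
  classical
  have hle : ∀ V, ∀ B ∈ measurableCylinders fun _ : I => E,
      (μ : Measure (I → E)) B ≤ ∫⁻ η, avg ν w V (B.indicator 1) η ∂(μ : Measure (I → E)) := by
    intro V B hB
    have hBm : MeasurableSet B := MeasurableSet.of_mem_measurableCylinders hB
    refine le_of_forall_one_lt_le_mul fun c' hc' hc't => ?_
    set c : ℝ≥0∞ := c' ^ (1 / 2 : ℝ) with hcdef
    have hc : 1 < c := ENNReal.one_lt_rpow hc' (by norm_num)
    have hcc : c * c = c' := by
      rw [hcdef, ← ENNReal.rpow_add_of_nonneg _ _ (by norm_num) (by norm_num)]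
      norm_num
    have hct : c ≠ ∞ := ENNReal.rpow_ne_top_of_nonneg (by norm_num) hc't
    obtain ⟨W₀, hW₀⟩ := hQ.avg_le hw V hc
    obtain ⟨V₁, S, hS, hBS⟩ := (mem_measurableCylinders _).1 hB
    set W := W₀ ∪ V₁ with hW
    obtain ⟨η₀⟩ : Nonempty (I → E) := nonempty_of_isProbabilityMeasure (μ : Measure (I → E))
    set F : (I → E) → ℝ≥0∞ := avg ν w V (B.indicator 1) with hF
    have hFm : Measurable F := measurable_avg hw V (measurable_one.indicator hBm)
    have hdep : DependsOn (B.indicator (1 : (I → E) → ℝ≥0∞)) (W : Set I) := by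
      intro σ σ' h
      have hr : V₁.restrict σ = V₁.restrict σ' := funext fun j => h j (by simp [hW])
      exact indicator_one_congr (by rw [hBS, mem_cylinder, mem_cylinder, hr])
    -- Freezing the spins off `W` at a fixed configuration makes the function local.
    set ext : (W → E) → I → E := fun y => updateFinset η₀ W y with hext
    have hextm : Measurable ext := measurable_updateFinset
    set G : (I → E) → ℝ≥0∞ := fun η => F (ext (W.restrict η)) with hG
    have hGm : Measurable G := hFm.comp (hextm.comp (Finset.measurable_restrict W))
    have hagree : ∀ η : I → E, ∀ i ∈ W, η i = ext (W.restrict η) i := by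
      intro η i hi
      simp [hext, updateFinset, hi]
    have hFG : ∀ η, F η ≤ c * G η := fun η =>
      hW₀ W Finset.subset_union_left _ (measurable_one.indicator hBm) hdep _ _ (hagree η)
    have hGF : ∀ η, G η ≤ c * F η := fun η =>
      hW₀ W Finset.subset_union_left _ (measurable_one.indicator hBm) hdep _ _
        (fun i hi => (hagree η i hi).symm)
    have hG1 : ∀ η, G η ≤ 1 := fun η => by
      rw [← avg_one hw V (ext (W.restrict η))]
      exact avg_mono V (fun σ => Set.indicator_le_self' (fun _ _ => zero_le) σ) _
    have hGlim := limsup_lintegral_le_of_tendsto_measure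
      (m := fun n => (m n : Measure (I → E))) (μ := (μ : Measure (I → E))) (U := U) hGm hG1
      fun t => tendsto_cylinder_of_dlr hw hb hlim hm ((mem_measurableCylinders _).2
        ⟨W, {y | t < F (ext y)}, measurableSet_lt measurable_const (hFm.comp hextm), rfl⟩)
    calc (μ : Measure (I → E)) B
        = limsup (fun n => (m n : Measure (I → E)) B) U :=
          (tendsto_cylinder_of_dlr hw hb hlim hm hB).limsup_eq.symm
      _ ≤ limsup (fun n => c * ∫⁻ η, G η ∂(m n : Measure (I → E))) U := by
          refine limsup_le_limsup ?_
          filter_upwards [hm V] with n hn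
          rw [← lintegral_indicator_one hBm, ← hn _ (measurable_one.indicator hBm),
            ← lintegral_const_mul _ hGm]
          exact lintegral_mono hFG
      _ = c * limsup (fun n => ∫⁻ η, G η ∂(m n : Measure (I → E))) U :=
          ENNReal.limsup_const_mul_of_ne_top hct
      _ ≤ c * ∫⁻ η, G η ∂(μ : Measure (I → E)) := by gcongr
      _ ≤ c * ∫⁻ η, c * F η ∂(μ : Measure (I → E)) := by gcongr with η; exact hGF η
      _ = c' * ∫⁻ η, F η ∂(μ : Measure (I → E)) := by
          rw [lintegral_const_mul _ hFm, ← mul_assoc, hcc]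
  refine ⟨inferInstance, fun V B hB => ?_⟩
  have hk : Measurable (spec ν w V) := by
    refine Measure.measurable_of_measurable_coe _ fun B hB => ?_
    simp only [spec_apply hw V _ hB]
    exact measurable_avg hw V (measurable_one.indicator hB)
  have hbind : ∀ B, MeasurableSet B → (μ : Measure (I → E)).bind (spec ν w V) B =
      ∫⁻ η, avg ν w V (B.indicator 1) η ∂(μ : Measure (I → E)) := fun B hB => by
    rw [Measure.bind_apply hB hk.aemeasurable]
    simp only [spec_apply hw V _ hB]
  have hprob : IsProbabilityMeasure ((μ : Measure (I → E)).bind (spec ν w V)) := by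
    constructor
    rw [hbind _ MeasurableSet.univ, Set.indicator_univ]
    simp [avg_one hw]
  have heq : (μ : Measure (I → E)) = (μ : Measure (I → E)).bind (spec ν w V) := by
    refine ext_of_generate_finite _ generateFrom_measurableCylinders.symm
      isPiSystem_measurableCylinders (fun B hB => ?_) (by simp)
    have hBm : MeasurableSet B := MeasurableSet.of_mem_measurableCylinders hB
    refine le_antisymm ((hle V B hB).trans_eq (hbind B hBm).symm) ?_
    -- The reverse inequality is the same inequality for the complement, since both measures have
    -- mass one.
    have h := (hle V Bᶜ (compl_mem_measurableCylinders hB)).trans_eq (hbind _ hBm.compl).symm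
    rw [prob_compl_eq_one_sub hBm, prob_compl_eq_one_sub hBm] at h
    exact (ENNReal.sub_le_sub_iff_left prob_le_one ENNReal.one_ne_top).1 h
  rw [← Measure.bind_apply hB hk.aemeasurable, ← heq]

lemma eventually_dlr_spec (hw : IsWeight ν w) (η : I → E) (V : Finset I) :
    ∀ᶠ Λ in (atTop : Filter (Finset I)), DLR ν w V (spec ν w Λ η) := by
  filter_upwards [eventually_ge_atTop V] with Λ hΛ using dlr_spec hw hΛ η

/-- Existence of Gibbs measures. -/
theorem exists_isGibbs [Nonempty E] (hw : IsWeight ν w) (hb : BoundedDensity ν w)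
    (hQ : QuasiLocal w) : ∃ μ, IsGibbs (spec ν w) μ := by
  obtain ⟨e⟩ := ‹Nonempty E›
  set η : I → E := fun _ => e
  set m : Finset I → ProbabilityMeasure (I → E) := fun Λ =>
    ⟨spec ν w Λ η, isProbabilityMeasure_spec hw Λ η⟩
  -- The probability measures on a compact metrizable space form a compact space, so the
  -- finite-volume distributions converge along any ultrafilter finer than `atTop`.
  set U : Ultrafilter (Finset I) := Ultrafilter.of atTop
  obtain ⟨μ, -, hμ⟩ := isCompact_univ.ultrafilter_le_nhds (U.map m) (by simp)
  exact ⟨μ, isGibbs_of_tendsto hw hb hQ (U := (U : Filter (Finset I))) (m := m) hμ fun V =>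
    (eventually_dlr_spec hw η V).filter_mono (Ultrafilter.of_le _)⟩

/-- If the Gibbs measure is unique, finite-volume distributions converge to it. -/
theorem tendsto_spec_of_unique (hw : IsWeight ν w) (hb : BoundedDensity ν w)
    (hQ : QuasiLocal w) {μ : Measure (I → E)} (hμ : ∀ ρ, IsGibbs (spec ν w) ρ → ρ = μ)
    (η : I → E) {B : Set (I → E)} (hB : B ∈ measurableCylinders fun _ : I => E) :
    Tendsto (fun Λ => spec ν w Λ η B) atTop (𝓝 (μ B)) := by
  set m : Finset I → ProbabilityMeasure (I → E) := fun Λ =>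
    ⟨spec ν w Λ η, isProbabilityMeasure_spec hw Λ η⟩
  -- Along each ultrafilter finer than `atTop` there is a limit; it is Gibbs, hence equal to `μ`.
  refine (tendsto_iff_ultrafilter _ _ _).2 fun U hU => ?_
  obtain ⟨ρ, -, hρ⟩ := isCompact_univ.ultrafilter_le_nhds (U.map m) (by simp)
  have hd : ∀ V, ∀ᶠ Λ in (U : Filter (Finset I)), DLR ν w V (m Λ) := fun V =>
    (eventually_dlr_spec hw η V).filter_mono hU
  rw [← hμ _ (isGibbs_of_tendsto hw hb hQ (U := (U : Filter (Finset I))) (m := m) hρ hd)]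
  exact tendsto_cylinder_of_dlr hw hb (m := m) hρ hd hB

end Existence

end RotatorPCA

namespace RotatorPCA

open Function Filter Topology

/-! ### Hamiltonians and Boltzmann weights of a summable potential -/

lemma abs_tsum_le_tsum {ι : Type*} {f g : ι → ℝ} (hg : Summable g) (h : ∀ i, |f i| ≤ g i) :
    |∑' i, f i| ≤ ∑' i, g i := by
  rw [← Real.norm_eq_abs]
  exact tsum_of_norm_bounded hg.hasSum h

namespace Potential

variable {I : Type}

/-- The supremum norm of the interaction `Φ_A`, as a real number. -/
noncomputable def supNorm (Φ : Potential I) (A : Finset I) : ℝ := (⨆ s : (A → Angle), ‖Φ A s‖ₑ).toReal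

/-- The energy of the interactions with support in the set `P` of finite sets of sites. -/
noncomputable def energy (Φ : Potential I) (P : Set (Finset I)) (σ : I → Angle) : ℝ :=
  ∑' A, P.indicator (fun A => Φ A fun a => σ a) A

/-- The finite sets that meet `Λ`. -/
def meeting (Λ : Finset I) : Set (Finset I) := {A | ∃ i ∈ A, i ∈ Λ}

lemma hamiltonian_eq_energy (Φ : Potential I) (Λ : Finset I) (σ : I → Angle) :
    Φ.hamiltonian Λ σ = Φ.energy (meeting Λ) σ :=
  tsum_subtype (meeting Λ) fun A => Φ A fun a => σ a

lemma supNorm_nonneg (Φ : Potential I) (A : Finset I) : 0 ≤ Φ.supNorm A := ENNReal.toReal_nonneg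

variable {Φ : Potential I}

lemma AbsolutelySummable.tsum_meeting_ne_top (h : Φ.AbsolutelySummable) (Λ : Finset I) :
    ∑' A, (meeting Λ).indicator (fun A : Finset I => ⨆ s : (A → Angle), ‖Φ A s‖ₑ) A ≠ ∞ := by
  classical
  have hle : ∀ A, (meeting Λ).indicator (fun A : Finset I => ⨆ s : (A → Angle), ‖Φ A s‖ₑ) A ≤
      ∑ i ∈ Λ, ({A | i ∈ A} : Set (Finset I)).indicator
        (fun A : Finset I => ⨆ s : (A → Angle), ‖Φ A s‖ₑ) A := by
    intro A
    by_cases hA : A ∈ meeting Λ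
    swap
    · rw [Set.indicator_of_notMem hA]
      exact zero_le
    rw [Set.indicator_of_mem hA]
    obtain ⟨i, hiA, hiΛ⟩ := hA
    refine le_trans ?_ (Finset.single_le_sum (fun _ _ => zero_le) hiΛ)
    rw [Set.indicator_of_mem (show A ∈ {A | i ∈ A} from hiA)]
  refine ne_top_of_le_ne_top ?_ (ENNReal.tsum_le_tsum hle)
  rw [Summable.tsum_finsetSum fun _ _ => ENNReal.summable]
  refine (ENNReal.sum_lt_top.2 fun i _ => ?_).ne
  rw [← tsum_subtype]
  exact h i

lemma AbsolutelySummable.summable_supNorm (h : Φ.AbsolutelySummable) (Λ : Finset I) :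
    Summable ((meeting Λ).indicator Φ.supNorm) := by
  have h1 := ENNReal.summable_toReal (h.tsum_meeting_ne_top Λ)
  refine h1.congr fun A => ?_
  by_cases hA : A ∈ meeting Λ <;> simp [hA, supNorm]

lemma AbsolutelySummable.abs_le_supNorm (h : Φ.AbsolutelySummable) {A : Finset I} {i : I}
    (hi : i ∈ A) (s : A → Angle) : |Φ A s| ≤ Φ.supNorm A := by
  have hne : (⨆ s : (A → Angle), ‖Φ A s‖ₑ) ≠ ∞ := by
    have := ENNReal.ne_top_of_tsum_ne_top (h i).ne ⟨A, hi⟩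
    exact this
  have h1 : ‖Φ A s‖ₑ ≤ ⨆ s : (A → Angle), ‖Φ A s‖ₑ := le_iSup (fun s => ‖Φ A s‖ₑ) s
  have := ENNReal.toReal_mono hne h1
  simpa [supNorm] using this

lemma AbsolutelySummable.abs_indicator_le (h : Φ.AbsolutelySummable) {Λ : Finset I}
    {P : Set (Finset I)} (hP : P ⊆ meeting Λ) (σ : I → Angle) (A : Finset I) :
    |P.indicator (fun A => Φ A fun a => σ a) A| ≤ (meeting Λ).indicator Φ.supNorm A := by
  by_cases hA : A ∈ P
  · obtain ⟨i, hi, -⟩ := hP hA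
    simpa [hA, hP hA] using h.abs_le_supNorm hi _
  · simpa [hA] using Set.indicator_nonneg (fun A _ => Φ.supNorm_nonneg A) A

lemma AbsolutelySummable.summable_energy (h : Φ.AbsolutelySummable) {Λ : Finset I}
    {P : Set (Finset I)} (hP : P ⊆ meeting Λ) (σ : I → Angle) :
    Summable (P.indicator fun A => Φ A fun a => σ a) :=
  Summable.of_abs (Summable.of_nonneg_of_le (fun _ => abs_nonneg _) (h.abs_indicator_le hP σ)
    (h.summable_supNorm Λ))

/-- A bound for the Hamiltonian in the volume `Λ`. -/
noncomputable def energyBound (Φ : Potential I) (Λ : Finset I) : ℝ := ∑' A, (meeting Λ).indicator Φ.supNorm A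

lemma AbsolutelySummable.abs_energy_le (h : Φ.AbsolutelySummable) {Λ : Finset I}
    {P : Set (Finset I)} (hP : P ⊆ meeting Λ) (σ : I → Angle) :
    |Φ.energy P σ| ≤ Φ.energyBound Λ :=
  abs_tsum_le_tsum (h.summable_supNorm Λ) (h.abs_indicator_le hP σ)

lemma AbsolutelySummable.energy_union (h : Φ.AbsolutelySummable) {Λ : Finset I}
    {P Q : Set (Finset I)} (hP : P ⊆ meeting Λ) (hQ : Q ⊆ meeting Λ) (hPQ : Disjoint P Q)
    (σ : I → Angle) : Φ.energy (P ∪ Q) σ = Φ.energy P σ + Φ.energy Q σ := by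
  rw [energy, energy, energy, ← (h.summable_energy hP σ).tsum_add (h.summable_energy hQ σ),
    Set.indicator_union_of_disjoint hPQ]

lemma AbsolutelySummable.measurable_energy [Countable I] (h : Φ.AbsolutelySummable)
    (hm : ∀ A, Measurable (Φ A)) {Λ : Finset I} {P : Set (Finset I)} (hP : P ⊆ meeting Λ) :
    Measurable (Φ.energy P) := by
  have hA : ∀ A, Measurable fun σ : I → Angle => P.indicator (fun A => Φ A fun a => σ a) A := by
    intro A
    by_cases hA : A ∈ P
    · simp only [Set.indicator_of_mem hA]
      exact (hm A).comp (measurable_pi_lambda _ fun a : A => measurable_pi_apply (a : I))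
    · simp [hA]
  refine measurable_of_tendsto_metrizable' (atTop : Filter (Finset (Finset I)))
    (f := fun F σ => ∑ A ∈ F, P.indicator (fun A => Φ A fun a => σ a) A)
    (fun F => Finset.measurable_sum F fun A _ => hA A) ?_
  exact tendsto_pi_nhds.2 fun σ => (h.summable_energy hP σ).hasSum

lemma dependsOn_energy {P : Set (Finset I)} {S : Set I} (hP : ∀ A ∈ P, ∀ i ∈ A, i ∈ S) :
    DependsOn (Φ.energy P) S := by
  intro σ σ' h
  refine tsum_congr fun A => ?_
  by_cases hA : A ∈ P
  · have : (fun a : A => σ a) = fun a : A => σ' a := funext fun a => h a (hP A hA a a.2)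
    simp [hA, this]
  · simp [hA]

/-- All but finitely many interactions meeting `Λ` have total norm below `δ / 2`. With `W` the union
of the exceptional sets, only that tail can differ, by at most twice its norm. -/
lemma AbsolutelySummable.exists_energy_le (h : Φ.AbsolutelySummable) (Λ : Finset I) {δ : ℝ}
    (hδ : 0 < δ) : ∃ W : Finset I, ∀ σ σ' : I → Angle, (∀ i ∈ W, σ i = σ' i) →
      |Φ.energy (meeting Λ) σ - Φ.energy (meeting Λ) σ'| ≤ δ := by
  classical
  have hs := h.summable_supNorm Λ
  obtain ⟨F, hF⟩ := ((tendsto_order.1 (tendsto_tsum_compl_atTop_zero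
    ((meeting Λ).indicator Φ.supNorm))).2 (δ / 2) (by positivity)).exists
  refine ⟨F.biUnion id, fun σ σ' hσ => ?_⟩
  have hle : ∀ A, |(meeting Λ).indicator (fun A => Φ A fun a => σ a) A -
      (meeting Λ).indicator (fun A => Φ A fun a => σ' a) A| ≤
      2 * ({A | A ∉ F} : Set (Finset I)).indicator ((meeting Λ).indicator Φ.supNorm) A := by
    intro A
    by_cases hA : A ∈ F
    · have : (fun a : A => σ a) = fun a : A => σ' a :=
        funext fun a => hσ a (Finset.mem_biUnion.2 ⟨A, hA, a.2⟩)
      by_cases hAm : A ∈ meeting Λ <;> simp [hA, this, hAm]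
    · rw [Set.indicator_of_mem (show A ∈ {A | A ∉ F} from hA), two_mul]
      exact (abs_sub _ _).trans (add_le_add (h.abs_indicator_le subset_rfl σ A)
        (h.abs_indicator_le subset_rfl σ' A))
  have hsi : Summable (({A | A ∉ F} : Set (Finset I)).indicator
    ((meeting Λ).indicator Φ.supNorm)) := hs.indicator _
  rw [energy, energy, ← (h.summable_energy subset_rfl σ).tsum_sub (h.summable_energy subset_rfl σ')]
  refine (abs_tsum_le_tsum (hsi.mul_left 2) hle).trans ?_
  rw [tsum_mul_left, ← tsum_subtype {A | A ∉ F} ((meeting Λ).indicator Φ.supNorm)]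
  have : ∑' A : {A // A ∉ F}, (meeting Λ).indicator Φ.supNorm A < δ / 2 := hF
  have h3 : ∑' A : ↑{A | A ∉ F}, (meeting Λ).indicator Φ.supNorm A < δ / 2 := this
  linarith

/-- The Boltzmann weight in the volume `V`, restricted to configurations with spins in `A`. -/
noncomputable def weight (Φ : Potential I) (A : I → Set Angle) (V : Finset I) (σ : I → Angle) : ℝ≥0∞ :=
  {σ : I → Angle | ∀ i ∈ V, σ i ∈ A i}.indicator
    (fun σ => ENNReal.ofReal (Real.exp (-Φ.hamiltonian V σ))) σ

lemma measurableSet_forall_mem {A : I → Set Angle} (hA : ∀ i, MeasurableSet (A i)) (V : Finset I) :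
    MeasurableSet {σ : I → Angle | ∀ i ∈ V, σ i ∈ A i} := by
  have : {σ : I → Angle | ∀ i ∈ V, σ i ∈ A i} = ⋂ i ∈ V, (fun σ : I → Angle => σ i) ⁻¹' A i := by
    ext; simp
  rw [this]
  exact Finset.measurableSet_biInter _ fun i _ => measurable_pi_apply i (hA i)

lemma measurable_weight [Countable I] (h : Φ.AbsolutelySummable) (hm : ∀ A, Measurable (Φ A))
    {A : I → Set Angle} (hA : ∀ i, MeasurableSet (A i)) (V : Finset I) :
    Measurable (Φ.weight A V) := by
  refine Measurable.indicator ?_ (measurableSet_forall_mem hA V)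
  simp only [hamiltonian_eq_energy]
  exact ENNReal.measurable_ofReal.comp (Real.measurable_exp.comp
    (h.measurable_energy hm subset_rfl).neg)

lemma weight_le (h : Φ.AbsolutelySummable) (A : I → Set Angle) (V : Finset I) (σ : I → Angle) :
    Φ.weight A V σ ≤ ENNReal.ofReal (Real.exp (Φ.energyBound V)) := by
  refine (Set.indicator_le_self' (fun _ _ => zero_le) σ).trans ?_
  rw [hamiltonian_eq_energy]
  gcongr
  exact (neg_le_abs _).trans (h.abs_energy_le subset_rfl σ)

lemma le_weight (h : Φ.AbsolutelySummable) (A : I → Set Angle) (V : Finset I) {σ : I → Angle}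
    (hσ : ∀ i ∈ V, σ i ∈ A i) :
    ENNReal.ofReal (Real.exp (-Φ.energyBound V)) ≤ Φ.weight A V σ := by
  rw [weight, Set.indicator_of_mem (show σ ∈ {σ : I → Angle | ∀ i ∈ V, σ i ∈ A i} from hσ),
    hamiltonian_eq_energy]
  gcongr
  exact (le_abs_self _).trans (h.abs_energy_le subset_rfl σ)

lemma quasiLocal_weight (h : Φ.AbsolutelySummable) (A : I → Set Angle) :
    QuasiLocal (Φ.weight A) := by
  classical
  intro V c hc
  -- The constant `c` may be infinite; truncation gives a real number whose logarithm is the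
  -- admissible change of energy.
  set b : ℝ≥0∞ := min c 2 with hb
  have hbt : b ≠ ∞ := ne_top_of_le_ne_top (by norm_num) (min_le_right c 2)
  have hb1 : 1 < b := lt_min hc (by norm_num)
  have hbr : 1 < b.toReal := by simpa using (ENNReal.toReal_lt_toReal ENNReal.one_ne_top hbt).2 hb1
  obtain ⟨W, hW⟩ := h.exists_energy_le V (Real.log_pos hbr)
  -- Including `V` ensures that both configurations satisfy the constraint or neither does.
  refine ⟨W ∪ V, fun σ σ' hσ => ?_⟩
  have hle := hW σ σ' fun i hi => hσ i (Finset.mem_union_left _ hi)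
  by_cases hA : ∀ i ∈ V, σ i ∈ A i
  · have hA' : ∀ i ∈ V, σ' i ∈ A i := fun i hi => by
      rw [← hσ i (Finset.mem_union_right _ hi)]; exact hA i hi
    refine le_trans ?_ (mul_le_mul_left (min_le_left c 2) _)
    rw [weight, weight, Set.indicator_of_mem (show σ ∈ {σ : I → Angle | ∀ i ∈ V, σ i ∈ A i} from hA),
      Set.indicator_of_mem (show σ' ∈ {σ : I → Angle | ∀ i ∈ V, σ i ∈ A i} from hA'), ← hb,
      ← ENNReal.ofReal_toReal hbt, ← ENNReal.ofReal_mul ENNReal.toReal_nonneg,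
      ← Real.exp_log (zero_lt_one.trans hbr), ← Real.exp_add, hamiltonian_eq_energy,
      hamiltonian_eq_energy]
    gcongr
    linarith [(abs_le.1 hle).1]
  · rw [weight, Set.indicator_of_notMem (show σ ∉ {σ : I → Angle | ∀ i ∈ V, σ i ∈ A i} from hA)]
    exact zero_le

lemma meeting_mono {V V' : Finset I} (h : V ⊆ V') : meeting V ⊆ meeting V' :=
  fun _ ⟨i, hi, hiV⟩ => ⟨i, hi, h hiV⟩

variable [DecidableEq I]

lemma le_lmarginal_weight [Countable I] (h : Φ.AbsolutelySummable)
    {A : I → Set Angle} (hA : ∀ i, MeasurableSet (A i)) (V : Finset I) (σ : I → Angle) :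
    ENNReal.ofReal (Real.exp (-Φ.energyBound V)) * ∏ i : V, (volume : Measure Angle) (A i) ≤
      lmarginal (fun _ => (volume : Measure Angle)) V (Φ.weight A V) σ := by
  rw [← Measure.pi_pi, ← lintegral_indicator_const (MeasurableSet.univ_pi fun i => hA _), lmarginal]
  refine lintegral_mono fun y => ?_
  refine Set.indicator_le' (fun y hy => le_weight h A V fun i hi => ?_) (fun _ _ => zero_le) y
  simpa [updateFinset, hi] using hy ⟨i, hi⟩ trivial

lemma isWeight_weight [Countable I] (h : Φ.AbsolutelySummable) (hm : ∀ A, Measurable (Φ A))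
    {A : I → Set Angle} (hA : ∀ i, MeasurableSet (A i))
    (hA0 : ∀ i, (volume : Measure Angle) (A i) ≠ 0) :
    IsWeight (volume : Measure Angle) (Φ.weight A) where
  measurable := measurable_weight h hm hA
  ne_zero V σ := by
    refine (lt_of_lt_of_le (pos_iff_ne_zero.2 ?_) (le_lmarginal_weight h hA V σ)).ne'
    refine mul_ne_zero ?_ (Finset.prod_ne_zero_iff.2 fun i _ => hA0 i)
    simp [Real.exp_pos]
  ne_top V σ := by
    refine ne_top_of_le_ne_top ?_ (lmarginal_mono (weight_le h A V) σ)
    rw [lmarginal, lintegral_const]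
    exact ENNReal.mul_ne_top ENNReal.ofReal_ne_top (measure_ne_top _ _)
  consistent V V' hV := by
    have hsub : meeting V' \ meeting V ⊆ meeting V' := Set.sdiff_subset
    -- The factor collects the constraint on `V' \ V` and the interactions that meet `V'` but not
    -- `V`; neither involves a spin in `V`.
    refine ⟨{σ : I → Angle | ∀ i ∈ V' \ V, σ i ∈ A i}.indicator
      (fun σ => ENNReal.ofReal (Real.exp (-Φ.energy (meeting V' \ meeting V) σ))), ?_, ?_, ?_⟩
    · exact Measurable.indicator (ENNReal.measurable_ofReal.comp (Real.measurable_exp.comp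
        (h.measurable_energy hm hsub).neg)) (measurableSet_forall_mem hA _)
    · intro σ σ' hσ
      have hE : Φ.energy (meeting V' \ meeting V) σ = Φ.energy (meeting V' \ meeting V) σ' :=
        dependsOn_energy (S := (V : Set I)ᶜ)
          (fun A hA i hi hiV => hA.2 ⟨i, hi, hiV⟩) hσ
      have hiff : σ ∈ {σ : I → Angle | ∀ i ∈ V' \ V, σ i ∈ A i} ↔
          σ' ∈ {σ : I → Angle | ∀ i ∈ V' \ V, σ i ∈ A i} := by
        refine forall₂_congr fun i hi => ?_
        rw [hσ i (by simpa using (Finset.mem_sdiff.1 hi).2)]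
      by_cases hσA : σ ∈ {σ : I → Angle | ∀ i ∈ V' \ V, σ i ∈ A i}
      · rw [Set.indicator_of_mem hσA, Set.indicator_of_mem (hiff.1 hσA), hE]
      · rw [Set.indicator_of_notMem hσA, Set.indicator_of_notMem (mt hiff.2 hσA)]
    · intro σ
      have hE : Φ.energy (meeting V') σ =
          Φ.energy (meeting V' \ meeting V) σ + Φ.energy (meeting V) σ := by
        rw [← h.energy_union hsub (meeting_mono hV) Set.disjoint_sdiff_left,
          Set.sdiff_union_of_subset (meeting_mono hV)]
      have hmem : (∀ i ∈ V', σ i ∈ A i) ↔ (∀ i ∈ V' \ V, σ i ∈ A i) ∧ ∀ i ∈ V, σ i ∈ A i := by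
        constructor
        · exact fun h => ⟨fun i hi => h i (Finset.sdiff_subset hi), fun i hi => h i (hV hi)⟩
        · rintro ⟨h1, h2⟩ i hi
          by_cases hiV : i ∈ V
          · exact h2 i hiV
          · exact h1 i (Finset.mem_sdiff.2 ⟨hi, hiV⟩)
      classical
      simp only [weight, Set.indicator_apply, Set.mem_ofPred_eq, hamiltonian_eq_energy, hE, hmem]
      by_cases h1 : ∀ i ∈ V' \ V, σ i ∈ A i
      · by_cases h2 : ∀ i ∈ V, σ i ∈ A i
        · rw [if_pos ⟨h1, h2⟩, if_pos h1, if_pos h2, neg_add, Real.exp_add,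
            ENNReal.ofReal_mul (Real.exp_pos _).le]
        · rw [if_neg (fun h => h2 h.2), if_neg h2, mul_zero]
      · rw [if_neg (fun h => h1 h.1), if_neg h1, zero_mul]

lemma boundedDensity_weight [Countable I] (h : Φ.AbsolutelySummable)
    {A : I → Set Angle} (hA : ∀ i, MeasurableSet (A i))
    (hA0 : ∀ i, (volume : Measure Angle) (A i) ≠ 0) :
    BoundedDensity (volume : Measure Angle) (Φ.weight A) := by
  intro V
  set a : ℝ≥0∞ := ENNReal.ofReal (Real.exp (-Φ.energyBound V)) *
    ∏ i : V, (volume : Measure Angle) (A i) with ha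
  have ha0 : a ≠ 0 :=
    mul_ne_zero (by simp [Real.exp_pos]) (Finset.prod_ne_zero_iff.2 fun i _ => hA0 i)
  have hat : a ≠ ∞ := ENNReal.mul_ne_top ENNReal.ofReal_ne_top
    (ENNReal.prod_ne_top fun i _ => measure_ne_top _ _)
  refine ⟨ENNReal.ofReal (Real.exp (Φ.energyBound V)) * a⁻¹,
    ENNReal.mul_ne_top ENNReal.ofReal_ne_top (ENNReal.inv_ne_top.2 ha0), fun σ => ?_⟩
  calc Φ.weight A V σ ≤ ENNReal.ofReal (Real.exp (Φ.energyBound V)) * (a⁻¹ * a) := by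
        rw [ENNReal.inv_mul_cancel ha0 hat, mul_one]; exact weight_le h A V σ
    _ ≤ _ := by rw [mul_assoc]; gcongr; exact le_lmarginal_weight h hA V σ

end Potential

end RotatorPCA

namespace RotatorPCA

open Function Filter Topology

/-! ### The arcs of the discretization -/

section Disc

variable {q : ℕ}

/-- The arc of angles with discretization `k`. -/
def arc (q : ℕ) (k : ZMod q) : Set Angle := {φ | disc q φ = k}

lemma measurable_disc : Measurable (disc q) := by
  have h : Measurable fun φ : Angle => (AddCircle.equivIco (2 * π) 0 φ : ℝ) :=
    measurable_subtype_coe.comp (AddCircle.measurableEquivIco (2 * π) 0).measurable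
  exact (measurable_from_top (f := fun n : ℕ => (n : ZMod q))).comp
    (Nat.measurable_floor.comp ((h.const_mul _).div_const _))

lemma measurableSet_arc [NeZero q] (k : ZMod q) : MeasurableSet (arc q k) :=
  measurable_disc (measurableSet_singleton k)

lemma volume_arc_ne_zero [NeZero q] (k : ZMod q) : (volume : Measure Angle) (arc q k) ≠ 0 := by
  have hq : (0 : ℝ) < q := Nat.cast_pos.2 (NeZero.pos q)
  have hπ := Real.two_pi_pos
  have hmp := AddCircle.measurePreserving_mk (2 * π) 0
  rw [← hmp.measure_preimage (measurableSet_arc k).nullMeasurableSet]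
  set a : ℝ := 2 * π * k.val / q with ha
  set b : ℝ := 2 * π * (k.val + 1) / q with hb
  -- The open arc avoids the endpoints, where the representatives in `[0, 2π)` used by `disc` differ
  -- from those in `(0, 2π]` used by `measurePreserving_mk`. Its length is `2π / q`.
  have hsub : Set.Ioo a b ⊆ (fun x : ℝ => (x : Angle)) ⁻¹' arc q k ∩ Set.Ioc 0 (0 + 2 * π) := by
    rintro x ⟨hax, hxb⟩
    have ha0 : 0 ≤ a := by positivity
    have hb2 : b ≤ 2 * π := by
      rw [hb, div_le_iff₀ hq]
      have : ((k.val : ℝ) + 1) ≤ q := by exact_mod_cast ZMod.val_lt k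
      gcongr
    have hx : x ∈ Set.Ico (0 : ℝ) (0 + 2 * π) := ⟨ha0.trans hax.le, by linarith⟩
    refine ⟨?_, ⟨by linarith, by linarith⟩⟩
    simp only [Set.mem_preimage, arc, Set.mem_ofPred_eq, disc]
    rw [AddCircle.equivIco_coe_eq hx]
    have : ⌊(q : ℝ) * x / (2 * π)⌋₊ = k.val := by
      rw [Nat.floor_eq_iff (by have := hx.1; positivity)]
      rw [ha, div_lt_iff₀ hq] at hax
      rw [hb, lt_div_iff₀ hq] at hxb
      constructor
      · rw [le_div_iff₀ hπ]; linarith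
      · rw [div_lt_iff₀ hπ]; linarith
    rw [this, ZMod.natCast_zmod_val]
  rw [Measure.restrict_apply (hmp.measurable (measurableSet_arc k))]
  refine (lt_of_lt_of_le ?_ (measure_mono hsub)).ne'
  rw [Real.volume_Ioo, ENNReal.ofReal_pos, ha, hb, sub_pos]
  gcongr
  linarith

end Disc

lemma join_eq_updateFinset {I E : Type} [DecidableEq I] (Λ : Finset I) (s : Λ → E) (η : I → E) :
    join Λ s (fun i => η i) = updateFinset η Λ s := by
  ext i
  by_cases hi : i ∈ Λ <;> simp [join, updateFinset, hi]

/-! ### The constrained models: unique Gibbs measures, measurable in the constraint -/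

namespace Potential

variable {I : Type} [DecidableEq I] {q : ℕ} {Φ : Potential I}

lemma weight_updateFinset (A : I → Set Angle) (V : Finset I) (η : I → Angle) (y : V → Angle) :
    open Classical in Φ.weight A V (updateFinset η V y) =
      if ∀ i : V, y i ∈ A i then
        ENNReal.ofReal (Real.exp (-Φ.hamiltonian V (updateFinset η V y))) else 0 := by
  classical
  have h : updateFinset η V y ∈ {σ : I → Angle | ∀ i ∈ V, σ i ∈ A i} ↔ ∀ i : V, y i ∈ A i := by
    constructor
    · intro h i
      simpa [updateFinset] using h i i.2
    · intro h i hi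
      simpa [updateFinset, hi] using h ⟨i, hi⟩
  by_cases hy : ∀ i : V, y i ∈ A i
  · rw [weight, Set.indicator_of_mem (h.2 hy), if_pos hy]
  · rw [weight, Set.indicator_of_notMem (mt h.1 hy), if_neg hy]

/-- The weights of the model constrained to `T(σ) = σ'`. -/
noncomputable abbrev arcWeight (Φ : Potential I) (q : ℕ) (σ' : I → ZMod q) :
    Finset I → (I → Angle) → ℝ≥0∞ := Φ.weight fun i => arc q (σ' i)

lemma arcWeight_updateFinset (σ' : I → ZMod q) (V : Finset I) (η : I → Angle) (y : V → Angle)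
    [Decidable (∀ i : V, disc q (y i) = σ' i)] :
    Φ.arcWeight q σ' V (updateFinset η V y) = if ∀ i : V, disc q (y i) = σ' i then
      ENNReal.ofReal (Real.exp (-Φ.hamiltonian V (updateFinset η V y))) else 0 := by
  rw [arcWeight, weight_updateFinset]
  by_cases h : ∀ i : V, disc q (y i) = σ' i
  · rw [if_pos h]; exact if_pos h
  · rw [if_neg h]; exact if_neg h

lemma constrainedPartition_eq_lmarginal (Λ : Finset I) (σ' : I → ZMod q) (η : I → Angle) :
    Φ.constrainedPartition q Λ (fun i => σ' i) (fun i => η i) =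
      lmarginal (fun _ => (volume : Measure Angle)) Λ (Φ.arcWeight q σ' Λ) η := by
  refine lintegral_congr fun y => ?_
  rw [arcWeight_updateFinset, join_eq_updateFinset]

lemma constrainedSpec_eq_spec (σ' : I → ZMod q) :
    Φ.constrainedSpec q σ' = spec (volume : Measure Angle) (Φ.arcWeight q σ') := by
  ext1 Λ
  ext1 η
  rw [constrainedSpec, spec, constrainedPartition_eq_lmarginal]
  congr 2
  · ext1 s
    exact join_eq_updateFinset Λ s η
  · congr 1
    ext1 s
    rw [arcWeight_updateFinset, join_eq_updateFinset]

lemma avg_weight_compl (A : I → Set Angle) (V : Finset I) (η : I → Angle) :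
    avg (volume : Measure Angle) (Φ.weight A) V
      ({σ : I → Angle | ∀ i ∈ V, σ i ∈ A i}ᶜ.indicator 1) η = 0 := by
  have : ∀ σ, Φ.weight A V σ * {σ : I → Angle | ∀ i ∈ V, σ i ∈ A i}ᶜ.indicator 1 σ = 0 := by
    intro σ
    by_cases h : σ ∈ {σ : I → Angle | ∀ i ∈ V, σ i ∈ A i}
    · rw [Set.indicator_of_notMem (by simpa using h), mul_zero]
    · rw [weight, Set.indicator_of_notMem h, zero_mul]
  simp [avg, this, lmarginal]

variable [Countable I]

lemma isWeight_arcWeight [NeZero q] (h : Φ.AbsolutelySummable) (hm : ∀ A, Measurable (Φ A))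
    (σ' : I → ZMod q) : IsWeight (volume : Measure Angle) (Φ.arcWeight q σ') :=
  isWeight_weight h hm (fun _ => measurableSet_arc _) fun _ => volume_arc_ne_zero _

lemma ae_spec_singleton_mem (h : Φ.AbsolutelySummable) (hm : ∀ A, Measurable (Φ A))
    {A : I → Set Angle} (hA : ∀ i, MeasurableSet (A i))
    (hA0 : ∀ i, (volume : Measure Angle) (A i) ≠ 0) (i : I) (η : I → Angle) :
    ∀ᵐ σ ∂spec (volume : Measure Angle) (Φ.weight A) {i} η, σ i ∈ A i := by
  have := avg_weight_compl (Φ := Φ) A {i} η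
  rw [← spec_apply (isWeight_weight h hm hA hA0) _ _ (measurableSet_forall_mem hA {i}).compl] at this
  rw [ae_iff]
  convert! this using 2
  ext σ
  simp

/-- Dobrushin's uniqueness condition gives existence and uniqueness of the constrained Gibbs
measure. -/
theorem existsUnique_isGibbs [NeZero q] (h : Φ.AbsolutelySummable) (hm : ∀ A, Measurable (Φ A))
    (hd : Φ.ConstrainedDobrushin q) (σ' : I → ZMod q) :
    ∃! μ, IsGibbs (Φ.constrainedSpec q σ') μ := by
  have hw := isWeight_arcWeight (q := q) h hm σ'
  obtain ⟨μ, hμ⟩ := exists_isGibbs hw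
    (boundedDensity_weight h (fun _ => measurableSet_arc _) fun _ => volume_arc_ne_zero _)
    (quasiLocal_weight h _)
  refine ⟨μ, by rwa [constrainedSpec_eq_spec], fun μ₂ hμ₂ => ?_⟩
  dsimp only at hμ₂
  rw [constrainedSpec_eq_spec] at hμ₂
  refine eq_of_dobrushin hw (Φ.interdependence q σ') (hd σ') (fun i => le_iSup
    (fun i => ∑' j, Φ.interdependence q σ' i j) i) (A := fun i => arc q (σ' i))
    (ae_spec_singleton_mem h hm (fun _ => measurableSet_arc _) fun _ => volume_arc_ne_zero _)
    (fun _ => measurableSet_arc _) ?_ ((quasiLocal_weight h _).spec_singleton_le hw) hμ₂ hμ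
  intro i j η η₂ hη hη₂ hηη B hB
  rw [← tsub_le_iff_left, interdependence, constrainedSpec_eq_spec]
  exact le_iSup_of_le η <| le_iSup_of_le η₂ <| le_iSup_of_le hη <| le_iSup_of_le hη₂ <|
    le_iSup_of_le hηη <| le_iSup_of_le B <| le_iSup_of_le hB le_rfl

lemma isGibbs_constrainedGibbs {σ' : I → ZMod q} (hu : ∃! μ, IsGibbs (Φ.constrainedSpec q σ') μ) :
    IsGibbs (Φ.constrainedSpec q σ') (Φ.constrainedGibbs q σ') := by
  rw [constrainedGibbs, dif_pos hu]
  exact hu.choose_spec.1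

lemma eq_constrainedGibbs {σ' : I → ZMod q} (hu : ∃! μ, IsGibbs (Φ.constrainedSpec q σ') μ)
    {μ : Measure (I → Angle)} (hμ : IsGibbs (Φ.constrainedSpec q σ') μ) :
    μ = Φ.constrainedGibbs q σ' :=
  hu.unique hμ (isGibbs_constrainedGibbs hu)

lemma measurable_arcWeight_prod [NeZero q] (h : Φ.AbsolutelySummable)
    (hm : ∀ A, Measurable (Φ A)) (V : Finset I) :
    Measurable fun p : (I → ZMod q) × (I → Angle) => Φ.arcWeight q p.1 V p.2 := by
  have hset : MeasurableSet {p : (I → ZMod q) × (I → Angle) | ∀ i ∈ V, disc q (p.2 i) = p.1 i} := by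
    have : {p : (I → ZMod q) × (I → Angle) | ∀ i ∈ V, disc q (p.2 i) = p.1 i} =
        ⋂ i ∈ V, {p : (I → ZMod q) × (I → Angle) | disc q (p.2 i) = p.1 i} := by
      ext; simp
    rw [this]
    refine Finset.measurableSet_biInter _ fun i _ => measurableSet_eq_fun ?_ ?_
    · exact measurable_disc.comp ((measurable_pi_apply i).comp measurable_snd)
    · exact (measurable_pi_apply i).comp measurable_fst
  have hexp : Measurable fun p : (I → ZMod q) × (I → Angle) =>
      ENNReal.ofReal (Real.exp (-Φ.hamiltonian V p.2)) := by
    simp only [hamiltonian_eq_energy]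
    exact ENNReal.measurable_ofReal.comp (Real.measurable_exp.comp
      ((h.measurable_energy hm subset_rfl).comp measurable_snd).neg)
  exact hexp.indicator hset

lemma measurable_lmarginal_prod {X : Type*} [MeasurableSpace X] (V : Finset I)
    {F : X × (I → Angle) → ℝ≥0∞} (hF : Measurable F) :
    Measurable fun p : X × (I → Angle) =>
      lmarginal (fun _ => (volume : Measure Angle)) V (fun σ => F (p.1, σ)) p.2 := by
  have hup : Measurable fun r : (X × (I → Angle)) × (V → Angle) =>
      (r.1.1, updateFinset r.1.2 V r.2) := by
    refine (measurable_fst.comp measurable_fst).prodMk (measurable_pi_lambda _ fun i => ?_)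
    by_cases hi : i ∈ V
    · simp only [updateFinset, hi, dite_true]
      exact (measurable_pi_apply (⟨i, hi⟩ : V)).comp measurable_snd
    · simp only [updateFinset, hi, dite_false]
      exact (measurable_pi_apply i).comp (measurable_snd.comp measurable_fst)
  exact (hF.comp hup).lintegral_prod_right'

lemma measurable_avg_arcWeight_prod [NeZero q] (h : Φ.AbsolutelySummable)
    (hm : ∀ A, Measurable (Φ A)) (V : Finset I) {f : (I → Angle) → ℝ≥0∞} (hf : Measurable f) :
    Measurable fun p : (I → ZMod q) × (I → Angle) =>
      avg (volume : Measure Angle) (Φ.arcWeight q p.1) V f p.2 :=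
  (measurable_lmarginal_prod V (measurable_arcWeight_prod h hm V)).inv.mul
    (measurable_lmarginal_prod V ((measurable_arcWeight_prod h hm V).mul (hf.comp measurable_snd)))

lemma measurable_avg_arcWeight_left [NeZero q] (h : Φ.AbsolutelySummable)
    (hm : ∀ A, Measurable (Φ A)) (V : Finset I) {f : (I → Angle) → ℝ≥0∞} (hf : Measurable f)
    (η : I → Angle) :
    Measurable fun σ' : I → ZMod q => avg (volume : Measure Angle) (Φ.arcWeight q σ') V f η := by
  have h1 := measurable_avg_arcWeight_prod (q := q) h hm V hf
  have h2 : Measurable fun σ' : I → ZMod q => (σ', η) := measurable_id.prodMk measurable_const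
  simpa only [comp_def] using h1.comp h2

lemma tendsto_avg_constrainedGibbs [NeZero q] (h : Φ.AbsolutelySummable)
    (hm : ∀ A, Measurable (Φ A)) {σ' : I → ZMod q}
    (hu : ∃! μ, IsGibbs (Φ.constrainedSpec q σ') μ) (η : I → Angle) {B : Set (I → Angle)}
    (hB : B ∈ measurableCylinders fun _ : I => Angle) :
    Tendsto (fun Λ => avg (volume : Measure Angle) (Φ.arcWeight q σ') Λ (B.indicator 1) η) atTop
      (𝓝 (Φ.constrainedGibbs q σ' B)) := by
  have hw := isWeight_arcWeight (q := q) h hm σ'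
  have hlim := tendsto_spec_of_unique hw
    (boundedDensity_weight h (fun _ => measurableSet_arc _) fun _ => volume_arc_ne_zero _)
    (quasiLocal_weight h _) (μ := Φ.constrainedGibbs q σ')
    (fun ρ hρ => eq_constrainedGibbs hu (by rwa [constrainedSpec_eq_spec])) η hB
  refine hlim.congr fun Λ => ?_
  exact spec_apply hw _ _ (MeasurableSet.of_mem_measurableCylinders hB)

/-- By uniqueness, the probability of a cylinder event is the limit of its finite-volume
probabilities with a fixed boundary condition, and these are measurable in the constraint. The
boundary condition `0` need not be admissible. -/
lemma measurable_constrainedGibbs [NeZero q] (h : Φ.AbsolutelySummable)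
    (hm : ∀ A, Measurable (Φ A)) (hu : ∀ σ', ∃! μ, IsGibbs (Φ.constrainedSpec q σ') μ) :
    Measurable fun σ' => Φ.constrainedGibbs q σ' := by
  have hp : ∀ σ', IsProbabilityMeasure (Φ.constrainedGibbs q σ') :=
    fun σ' => (isGibbs_constrainedGibbs (hu σ')).1
  refine Measurable.measure_of_isPiSystem_of_isProbabilityMeasure
    generateFrom_measurableCylinders.symm isPiSystem_measurableCylinders fun B hB => ?_
  exact measurable_of_tendsto_metrizable' (atTop : Filter (Finset I))
    (fun Λ => measurable_avg_arcWeight_left h hm Λ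
      (measurable_one.indicator (MeasurableSet.of_mem_measurableCylinders hB)) 0)
    (tendsto_pi_nhds.2 fun σ' => tendsto_avg_constrainedGibbs h hm (hu σ') 0 hB)

/-- The kernel that maps `σ'` to the constrained Gibbs measure. -/
noncomputable def gibbsKernel [NeZero q] (h : Φ.AbsolutelySummable) (hm : ∀ A, Measurable (Φ A))
    (hu : ∀ σ', ∃! μ, IsGibbs (Φ.constrainedSpec q σ') μ) : Kernel (I → ZMod q) (I → Angle) :=
  ⟨fun σ' => Φ.constrainedGibbs q σ', measurable_constrainedGibbs h hm hu⟩

lemma isMarkovKernel_gibbsKernel [NeZero q] (h : Φ.AbsolutelySummable)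
    (hm : ∀ A, Measurable (Φ A)) (hu : ∀ σ', ∃! μ, IsGibbs (Φ.constrainedSpec q σ') μ) :
    IsMarkovKernel (gibbsKernel h hm hu) :=
  ⟨fun σ' => (isGibbs_constrainedGibbs (hu σ')).1⟩

lemma ae_disc_eq_constrainedGibbs [NeZero q] (h : Φ.AbsolutelySummable)
    (hm : ∀ A, Measurable (Φ A)) {σ' : I → ZMod q}
    (hu : ∃! μ, IsGibbs (Φ.constrainedSpec q σ') μ) :
    ∀ᵐ σ ∂Φ.constrainedGibbs q σ', (fun i => disc q (σ i)) = σ' := by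
  have hw := isWeight_arcWeight (q := q) h hm σ'
  have hG := isGibbs_constrainedGibbs hu
  rw [constrainedSpec_eq_spec] at hG
  have hall : ∀ᵐ σ ∂Φ.constrainedGibbs q σ', ∀ i, disc q (σ i) = σ' i := by
    refine ae_all_iff.2 fun i => ?_
    have hms := measurableSet_forall_mem (fun i => measurableSet_arc (σ' i)) {i}
    have := hG.2 {i} _ hms.compl
    simp only [spec_apply hw _ _ hms.compl, avg_weight_compl, lintegral_zero] at this
    rw [ae_iff]
    convert! this.symm using 2
    ext σ
    simp [arc]
  filter_upwards [hall] with σ hσ using funext hσ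

end Potential

end RotatorPCA

namespace RotatorPCA

open Function Filter Topology

/-! ### Gluing configurations inside and outside a finite volume -/

section Embedding

variable {I E : Type} {Λ : Finset I}

lemma join_of_mem {s : Λ → E} {ζ : {i // i ∉ Λ} → E} {i : I} (hi : i ∈ Λ) :
    join Λ s ζ i = s ⟨i, hi⟩ := by simp [join, hi]

lemma join_of_notMem {s : Λ → E} {ζ : {i // i ∉ Λ} → E} {i : I} (hi : i ∉ Λ) :
    join Λ s ζ i = ζ ⟨i, hi⟩ := by simp [join, hi]

lemma join_apply_compl (s : Λ → E) (ζ : {i // i ∉ Λ} → E) (i : {i // i ∉ Λ}) :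
    join Λ s ζ i = ζ i := join_of_notMem i.2

lemma join_comp_subtype (s : Λ → E) (ζ : {i // i ∉ Λ} → E) :
    (fun i : {i // i ∉ Λ} => join Λ s ζ i) = ζ := funext fun i => join_of_notMem i.2

lemma join_comp_coe (s : Λ → E) (ζ : {i // i ∉ Λ} → E) :
    (fun i : Λ => join Λ s ζ i) = s := funext fun i => join_of_mem i.2

lemma updateFinset_join [DecidableEq I] (s s₀ : Λ → E) (ζ : {i // i ∉ Λ} → E) :
    updateFinset (join Λ s₀ ζ) Λ s = join Λ s ζ := by
  rw [← join_eq_updateFinset, join_comp_subtype]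

lemma update_join [DecidableEq I] (s : Λ → E) (ζ : {i // i ∉ Λ} → E) (i : {i // i ∉ Λ}) (x : E) :
    update (join Λ s ζ) i x = join Λ s (update ζ i x) := by
  ext k
  rcases eq_or_ne k i with rfl | hk
  · rw [update_self, join_of_notMem i.2, update_self]
  · rw [update_of_ne hk]
    by_cases hkΛ : k ∈ Λ
    · rw [join_of_mem hkΛ, join_of_mem hkΛ]
    · rw [join_of_notMem hkΛ, join_of_notMem hkΛ, update_of_ne]
      exact fun h => hk (congrArg Subtype.val h)

variable [MeasurableSpace E]

lemma measurable_join : Measurable fun p : (Λ → E) × ({i // i ∉ Λ} → E) => join Λ p.1 p.2 := by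
  refine measurable_pi_lambda _ fun i => ?_
  by_cases hi : i ∈ Λ
  · simp only [join_of_mem hi]
    exact (measurable_pi_apply (⟨i, hi⟩ : Λ)).comp measurable_fst
  · simp only [join_of_notMem hi]
    exact (measurable_pi_apply (⟨i, hi⟩ : {i // i ∉ Λ})).comp measurable_snd

lemma measurable_join_right (s : Λ → E) : Measurable (join Λ s : ({i // i ∉ Λ} → E) → I → E) := by
  have h : Measurable fun ζ : {i // i ∉ Λ} → E => (s, ζ) := measurable_const.prodMk measurable_id
  simpa only [comp_def] using measurable_join.comp h

variable [DecidableEq I] {ν : Measure E}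

lemma lmarginal_join (s₀ : Λ → E) (ζ : {i // i ∉ Λ} → E) (f : (I → E) → ℝ≥0∞) :
    lmarginal (fun _ => ν) Λ f (join Λ s₀ ζ) =
      ∫⁻ s, f (join Λ s ζ) ∂Measure.pi fun _ : Λ => ν := by
  simp only [lmarginal, updateFinset_join]

lemma lmarginal_comp_join [SigmaFinite ν] (s₀ : Λ → E) {f : (I → E) → ℝ≥0∞} (hf : Measurable f)
    (W : Finset {i // i ∉ Λ}) (ζ : {i // i ∉ Λ} → E) :
    lmarginal (fun _ => ν) W (fun ζ => f (join Λ s₀ ζ)) ζ =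
      lmarginal (fun _ => ν) (W.map (Embedding.subtype _)) f (join Λ s₀ ζ) := by
  have hfj : Measurable fun ζ => f (join Λ s₀ ζ) := hf.comp (measurable_join_right s₀)
  induction W using Finset.induction_on generalizing ζ with
  | empty => simp
  | insert i W hi ih =>
    have hi' : (i : I) ∉ W.map (Embedding.subtype _) := by simpa using fun _ => hi
    rw [Finset.map_insert, lmarginal_insert _ hfj hi, Embedding.coe_subtype,
      lmarginal_insert _ hf hi']
    refine lintegral_congr fun x => ?_
    rw [ih, update_join]

end Embedding

/-! ### Deleting the interactions with a finite volume and restoring them -/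

namespace Potential

variable {I : Type} {Φ : Potential I}

lemma AbsolutelySummable.restrict (h : Φ.AbsolutelySummable) (p : I → Prop) :
    (Φ.restrict p).AbsolutelySummable := by
  intro i
  refine lt_of_le_of_lt ?_ (h i)
  have hinj : Injective fun A : {A : Finset {i // p i} // i ∈ A} =>
      (⟨A.1.map (Embedding.subtype p), Finset.mem_map_of_mem _ A.2⟩ : {A : Finset I // i.1 ∈ A}) := by
    intro A B hAB
    exact Subtype.ext (Finset.map_injective _ (congrArg Subtype.val hAB))
  refine le_trans (ENNReal.tsum_le_tsum fun A => ?_) (ENNReal.tsum_comp_le_tsum_of_injective hinj _)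
  exact iSup_le fun s => le_iSup (fun s => ‖Φ (A.1.map (Embedding.subtype p)) s‖ₑ) _

lemma measurable_restrict (hm : ∀ A, Measurable (Φ A)) (p : I → Prop) (A : Finset {i // p i}) :
    Measurable (Φ.restrict p A) :=
  (hm _).comp (measurable_pi_lambda _ fun _ => measurable_pi_apply _)

/-- The sets that meet `V` but not `Λ` are exactly the images of the sets off `Λ` that meet `W`, so
the sum is reindexed along an injection whose range contains every nonzero term. -/
lemma hamiltonian_restrict [DecidableEq I] (Λ V : Finset I) (W : Finset {i // i ∉ Λ})
    (hW : ∀ i, i ∈ W ↔ (i : I) ∈ V) (σ : I → Angle) :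
    (Φ.restrict fun i => i ∉ Λ).hamiltonian W (fun i => σ i) =
      Φ.energy (meeting V \ meeting Λ) σ := by
  rw [hamiltonian_eq_energy]
  have hinj : Injective fun A : Finset {i // i ∉ Λ} => A.map (Embedding.subtype _) :=
    Finset.map_injective _
  rw [energy, energy, ← hinj.tsum_eq]
  · refine tsum_congr fun A => ?_
    have hiff : A ∈ meeting W ↔ A.map (Embedding.subtype _) ∈ meeting V \ meeting Λ := by
      constructor
      · rintro ⟨i, hiA, hiW⟩
        refine ⟨⟨i, Finset.mem_map_of_mem _ hiA, (hW i).1 hiW⟩, ?_⟩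
        rintro ⟨k, hk, hkΛ⟩
        exact Finset.property_of_mem_map_subtype A hk hkΛ
      · rintro ⟨⟨k, hk, hkV⟩, -⟩
        obtain ⟨i, hi, rfl⟩ := Finset.mem_map.1 hk
        exact ⟨i, hi, (hW i).2 hkV⟩
    by_cases hA : A ∈ meeting W
    · rw [Set.indicator_of_mem hA, Set.indicator_of_mem (hiff.1 hA)]
      rfl
    · rw [Set.indicator_of_notMem hA, Set.indicator_of_notMem (mt hiff.2 hA)]
  · intro A hA
    have hA' : A ∈ meeting V \ meeting Λ := by
      by_contra h
      exact hA (Set.indicator_of_notMem h _)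
    exact ⟨A.subtype fun i => i ∉ Λ, Finset.subtype_map_of_mem fun i hi hiΛ => hA'.2 ⟨i, hi, hiΛ⟩⟩

/-- The interactions meeting `V` split into those that meet `Λ` and those that do not. The latter
are the Hamiltonian of the model off `Λ`, so the Boltzmann weight factorizes. -/
lemma weight_eq_restrict_mul [DecidableEq I] (h : Φ.AbsolutelySummable) (A : I → Set Angle)
    {Λ V : Finset I} (hΛ : Λ ⊆ V) (W : Finset {i // i ∉ Λ}) (hW : ∀ i, i ∈ W ↔ (i : I) ∈ V)
    (σ : I → Angle) :
    Φ.weight A V σ =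
      (Φ.restrict fun i => i ∉ Λ).weight (fun i => A i) W (fun i => σ i) * Φ.weight A Λ σ := by
  classical
  have hE : Φ.energy (meeting V) σ =
      Φ.energy (meeting V \ meeting Λ) σ + Φ.energy (meeting Λ) σ := by
    rw [← h.energy_union Set.sdiff_subset (meeting_mono hΛ) Set.disjoint_sdiff_left,
      Set.sdiff_union_of_subset (meeting_mono hΛ)]
  have hmem : (∀ i ∈ V, σ i ∈ A i) ↔ (∀ i ∈ W, σ i ∈ A i) ∧ ∀ i ∈ Λ, σ i ∈ A i := by
    constructor
    · exact fun h => ⟨fun i hi => h i ((hW i).1 hi), fun i hi => h i (hΛ hi)⟩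
    · rintro ⟨h1, h2⟩ i hi
      by_cases hiΛ : i ∈ Λ
      · exact h2 i hiΛ
      · exact h1 ⟨i, hiΛ⟩ ((hW ⟨i, hiΛ⟩).2 hi)
  simp only [weight, Set.indicator_apply, Set.mem_ofPred_eq, hmem, hamiltonian_restrict Λ V W hW]
  rw [hamiltonian_eq_energy, hamiltonian_eq_energy, hE]
  by_cases h1 : ∀ i ∈ W, σ i ∈ A i
  · by_cases h2 : ∀ i ∈ Λ, σ i ∈ A i
    · rw [if_pos ⟨h1, h2⟩, if_pos h1, if_pos h2, neg_add, Real.exp_add,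
        ENNReal.ofReal_mul (Real.exp_pos _).le]
    · rw [if_neg (fun h => h2 h.2), if_neg h2, mul_zero]
  · rw [if_neg (fun h => h1 h.1), if_neg h1, zero_mul]

/-- The unnormalized measure obtained from a measure on the configurations off `Λ` by adding the
spins in `Λ` with their Boltzmann weight. -/
noncomputable def extend (Φ : Potential I) (A : I → Set Angle) (Λ : Finset I)
    (ρ : Measure ({i // i ∉ Λ} → Angle)) : Measure (I → Angle) :=
  (((Measure.pi fun _ : Λ => (volume : Measure Angle)).prod ρ).map
    fun p => join Λ p.1 p.2).withDensity (Φ.weight A Λ)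

variable [DecidableEq I] [Countable I]

lemma lintegral_extend (h : Φ.AbsolutelySummable) (hm : ∀ A, Measurable (Φ A))
    {A : I → Set Angle} (hA : ∀ i, MeasurableSet (A i)) (Λ : Finset I)
    (ρ : Measure ({i // i ∉ Λ} → Angle)) [SFinite ρ] {f : (I → Angle) → ℝ≥0∞} (hf : Measurable f) :
    ∫⁻ σ, f σ ∂Φ.extend A Λ ρ = ∫⁻ ζ, lmarginal (fun _ => (volume : Measure Angle)) Λ
      (fun σ => Φ.weight A Λ σ * f σ) (join Λ 0 ζ) ∂ρ := by
  have hw := measurable_weight h hm hA Λ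
  have hwf : Measurable fun σ => Φ.weight A Λ σ * f σ := hw.mul hf
  have h1 : ∫⁻ σ, f σ ∂Φ.extend A Λ ρ = ∫⁻ σ, Φ.weight A Λ σ * f σ
      ∂(((Measure.pi fun _ : Λ => (volume : Measure Angle)).prod ρ).map
        fun p => join Λ p.1 p.2) := lintegral_withDensity_eq_lintegral_mul _ hw hf
  have h2 : Measurable fun p : (Λ → Angle) × ({i // i ∉ Λ} → Angle) =>
    Φ.weight A Λ (join Λ p.1 p.2) * f (join Λ p.1 p.2) := hwf.comp measurable_join
  rw [h1, lintegral_map hwf measurable_join, lintegral_prod_symm' _ h2]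
  simp only [lmarginal_join]

variable {A : I → Set Angle}

/-- It is enough to treat volumes that contain `Λ`. There, the DLR equation of `ρ` off `Λ` and the
factorization of the weight give `key`: the integral of `f` against the extension depends on `f`
only through the integral of `weight * f` over the whole volume, and averaging `f` in that volume
does not change it. -/
lemma dlr_extend (h : Φ.AbsolutelySummable) (hm : ∀ A, Measurable (Φ A))
    (hA : ∀ i, MeasurableSet (A i)) (hA0 : ∀ i, (volume : Measure Angle) (A i) ≠ 0)
    (Λ : Finset I) {ρ : Measure ({i // i ∉ Λ} → Angle)}
    (hρ : IsGibbs (spec (volume : Measure Angle)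
      ((Φ.restrict fun i => i ∉ Λ).weight fun i => A i)) ρ) (V : Finset I) :
    DLR (volume : Measure Angle) (Φ.weight A) V (Φ.extend A Λ ρ) := by
  have hp := hρ.1
  have hw := isWeight_weight h hm hA hA0
  have hwJ := isWeight_weight (h.restrict fun i => i ∉ Λ) (measurable_restrict hm fun i => i ∉ Λ)
    (A := fun i : {i // i ∉ Λ} => A i) (fun i => hA i) (fun i => hA0 i)
  refine DLR.mono hw (Finset.subset_union_left : V ⊆ V ∪ Λ) ?_
  set V' := V ∪ Λ
  have hΛV : Λ ⊆ V' := Finset.subset_union_right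
  set W : Finset {i // i ∉ Λ} := V'.subtype fun i => i ∉ Λ with hWdef
  have hW : ∀ i, i ∈ W ↔ (i : I) ∈ V' := fun i => Finset.mem_subtype
  have hWmap : W.map (Embedding.subtype _) = V' \ Λ := by
    rw [hWdef, Finset.subtype_map]
    ext i
    simp
  have key : ∀ f : (I → Angle) → ℝ≥0∞, Measurable f → ∫⁻ σ, f σ ∂Φ.extend A Λ ρ =
      ∫⁻ ζ, (lmarginal (fun _ => (volume : Measure Angle)) W
        ((Φ.restrict fun i => i ∉ Λ).weight (fun i => A i) W) ζ)⁻¹ *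
        lmarginal (fun _ => (volume : Measure Angle)) V' (fun σ => Φ.weight A V' σ * f σ)
          (join Λ 0 ζ) ∂ρ := by
    intro f hf
    have hwf : Measurable fun σ => Φ.weight A Λ σ * f σ := (hw.measurable Λ).mul hf
    have hwf' : Measurable fun σ => Φ.weight A V' σ * f σ := (hw.measurable V').mul hf
    have hL := hwf.lmarginal (fun _ => (volume : Measure Angle)) (s := Λ)
    have hL' := hwf'.lmarginal (fun _ => (volume : Measure Angle)) (s := Λ)
    rw [lintegral_extend h hm hA Λ ρ hf]
    refine (((isGibbs_spec_iff hwJ).1 hρ).2 W _ (hL.comp (measurable_join_right 0))).symm.trans ?_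
    refine lintegral_congr fun ζ => ?_
    rw [avg]
    congr 1
    have h1 : ∀ ζ : {i // i ∉ Λ} → Angle,
        (Φ.restrict fun i => i ∉ Λ).weight (fun i => A i) W ζ *
          (lmarginal (fun _ => (volume : Measure Angle)) Λ (fun σ => Φ.weight A Λ σ * f σ) ∘
            join Λ 0) ζ =
        lmarginal (fun _ => (volume : Measure Angle)) Λ (fun σ => Φ.weight A V' σ * f σ)
          (join Λ 0 ζ) := by
      intro ζ
      rw [comp_apply, lmarginal_join, lmarginal_join, ← lintegral_const_mul]
      · refine lintegral_congr fun s => ?_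
        rw [weight_eq_restrict_mul h A hΛV W hW, join_comp_subtype, mul_assoc]
      · have h2 : Measurable fun s : Λ → Angle => join Λ s ζ := by
          have h : Measurable fun s : Λ → Angle => (s, ζ) := measurable_id.prodMk measurable_const
          simpa only [comp_def] using measurable_join.comp h
        exact hwf.comp h2
    simp only [h1]
    rw [lmarginal_comp_join 0 hL', hWmap, ← lmarginal_of_subset hΛV hwf']
  intro f hf
  rw [key f hf, key _ (measurable_avg hw V' hf)]
  simp only [lmarginal_weight_mul_avg hw V']

lemma extend_univ (h : Φ.AbsolutelySummable) (hm : ∀ A, Measurable (Φ A))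
    (hA : ∀ i, MeasurableSet (A i)) (Λ : Finset I)
    (ρ : Measure ({i // i ∉ Λ} → Angle)) [SFinite ρ] :
    Φ.extend A Λ ρ Set.univ = ∫⁻ ζ, lmarginal (fun _ => (volume : Measure Angle)) Λ
      (Φ.weight A Λ) (join Λ 0 ζ) ∂ρ := by
  rw [← lintegral_one, lintegral_extend h hm hA Λ ρ measurable_const]
  simp

lemma extend_univ_ne_zero (h : Φ.AbsolutelySummable) (hm : ∀ A, Measurable (Φ A))
    (hA : ∀ i, MeasurableSet (A i)) (hA0 : ∀ i, (volume : Measure Angle) (A i) ≠ 0) (Λ : Finset I)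
    (ρ : Measure ({i // i ∉ Λ} → Angle)) [IsProbabilityMeasure ρ] :
    Φ.extend A Λ ρ Set.univ ≠ 0 := by
  rw [extend_univ h hm hA]
  refine (lt_of_lt_of_le ?_ (lintegral_mono fun ζ => le_lmarginal_weight h hA Λ (join Λ 0 ζ))).ne'
  rw [lintegral_const, measure_univ, mul_one]
  exact pos_iff_ne_zero.2
    (mul_ne_zero (by simp [Real.exp_pos]) (Finset.prod_ne_zero_iff.2 fun i _ => hA0 i))

lemma extend_univ_ne_top (h : Φ.AbsolutelySummable) (hm : ∀ A, Measurable (Φ A))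
    (hA : ∀ i, MeasurableSet (A i)) (Λ : Finset I)
    (ρ : Measure ({i // i ∉ Λ} → Angle)) [IsProbabilityMeasure ρ] :
    Φ.extend A Λ ρ Set.univ ≠ ∞ := by
  rw [extend_univ h hm hA]
  refine ne_top_of_le_ne_top ?_
    (lintegral_mono fun ζ => lmarginal_mono (weight_le h A Λ) (join Λ 0 ζ))
  simp only [lmarginal, lintegral_const, measure_univ, mul_one]
  exact ENNReal.mul_ne_top ENNReal.ofReal_ne_top (measure_ne_top _ _)

lemma isGibbs_extend (h : Φ.AbsolutelySummable) (hm : ∀ A, Measurable (Φ A))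
    (hA : ∀ i, MeasurableSet (A i)) (hA0 : ∀ i, (volume : Measure Angle) (A i) ≠ 0)
    (Λ : Finset I) {ρ : Measure ({i // i ∉ Λ} → Angle)}
    (hρ : IsGibbs (spec (volume : Measure Angle)
      ((Φ.restrict fun i => i ∉ Λ).weight fun i => A i)) ρ) :
    IsGibbs (spec (volume : Measure Angle) (Φ.weight A))
      ((Φ.extend A Λ ρ Set.univ)⁻¹ • Φ.extend A Λ ρ) := by
  have hp := hρ.1
  refine (isGibbs_spec_iff (isWeight_weight h hm hA hA0)).2 ⟨⟨?_⟩, fun V f hf => ?_⟩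
  · rw [Measure.smul_apply, smul_eq_mul]
    exact ENNReal.inv_mul_cancel (extend_univ_ne_zero h hm hA hA0 Λ ρ)
      (extend_univ_ne_top h hm hA Λ ρ)
  · rw [lintegral_smul_measure, lintegral_smul_measure, dlr_extend h hm hA hA0 Λ hρ V f hf]

/-- The measure off `Λ` can be recovered from its extension. -/
lemma lintegral_extend_inv (h : Φ.AbsolutelySummable) (hm : ∀ A, Measurable (Φ A))
    (hA : ∀ i, MeasurableSet (A i)) (hA0 : ∀ i, (volume : Measure Angle) (A i) ≠ 0) (Λ : Finset I)
    (ρ : Measure ({i // i ∉ Λ} → Angle)) [SFinite ρ] {f : ({i // i ∉ Λ} → Angle) → ℝ≥0∞}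
    (hf : Measurable f) :
    ∫⁻ σ, (lmarginal (fun _ => (volume : Measure Angle)) Λ (Φ.weight A Λ) σ)⁻¹ *
      f (fun i => σ i) ∂Φ.extend A Λ ρ = ∫⁻ ζ, f ζ ∂ρ := by
  have hw := isWeight_weight h hm hA hA0
  have hg : Measurable fun σ : I → Angle =>
      (lmarginal (fun _ => (volume : Measure Angle)) Λ (Φ.weight A Λ) σ)⁻¹ *
        f (fun i => σ i) :=
    ((hw.measurable Λ).lmarginal _).inv.mul
      (hf.comp (measurable_pi_lambda _ fun i => measurable_pi_apply (i : I)))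
  rw [lintegral_extend h hm hA Λ ρ hg]
  refine lintegral_congr fun ζ => ?_
  have hdep : DependsOn (fun σ : I → Angle =>
      (lmarginal (fun _ => (volume : Measure Angle)) Λ (Φ.weight A Λ) σ)⁻¹ *
        f (fun i => σ i)) ((Λ : Set I)ᶜ) := by
    intro σ σ' hσ
    have h1 : (fun i : {i // i ∉ Λ} => σ i) = fun i : {i // i ∉ Λ} => σ' i :=
      funext fun i => hσ i (by simp)
    simp only [h1]
    rw [dependsOn_lmarginal Λ _ hσ]
  simp only [mul_comm (Φ.weight A Λ _)]
  rw [lmarginal_mul_left Λ (hw.measurable Λ) hdep, join_comp_subtype, mul_right_comm,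
    ENNReal.inv_mul_cancel (hw.ne_zero _ _) (hw.ne_top _ _), one_mul]

/-- Uniqueness of the Gibbs measure is inherited by the model on the complement of a finite set. -/
lemma eq_of_isGibbs_restrict (h : Φ.AbsolutelySummable) (hm : ∀ A, Measurable (Φ A))
    (hA : ∀ i, MeasurableSet (A i)) (hA0 : ∀ i, (volume : Measure Angle) (A i) ≠ 0)
    (hu : ∀ μ μ₂, IsGibbs (spec (volume : Measure Angle) (Φ.weight A)) μ →
      IsGibbs (spec (volume : Measure Angle) (Φ.weight A)) μ₂ → μ = μ₂)
    (Λ : Finset I) {ρ ρ₂ : Measure ({i // i ∉ Λ} → Angle)}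
    (hρ : IsGibbs (spec (volume : Measure Angle)
      ((Φ.restrict fun i => i ∉ Λ).weight fun i => A i)) ρ)
    (hρ₂ : IsGibbs (spec (volume : Measure Angle)
      ((Φ.restrict fun i => i ∉ Λ).weight fun i => A i)) ρ₂) : ρ = ρ₂ := by
  -- The normalized extensions coincide by uniqueness of the full model. Dividing by the partition
  -- function in `Λ` recovers `ρ` and `ρ₂` up to constants, and the test function `1` shows that
  -- these agree.
  have heq := hu _ _ (isGibbs_extend h hm hA hA0 Λ hρ) (isGibbs_extend h hm hA hA0 Λ hρ₂)
  set T : (({i // i ∉ Λ} → Angle) → ℝ≥0∞) → ℝ≥0∞ := fun f =>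
    ∫⁻ σ, (lmarginal (fun _ => (volume : Measure Angle)) Λ (Φ.weight A Λ) σ)⁻¹ *
      f (fun i => σ i) ∂((Φ.extend A Λ ρ Set.univ)⁻¹ • Φ.extend A Λ ρ) with hT
  have hp := hρ.1
  have hp₂ := hρ₂.1
  have h1 : ∀ f, Measurable f → T f = (Φ.extend A Λ ρ Set.univ)⁻¹ * ∫⁻ ζ, f ζ ∂ρ := by
    intro f hf
    simp only [hT]
    rw [lintegral_smul_measure, lintegral_extend_inv h hm hA hA0 Λ ρ hf, smul_eq_mul]
  have h2 : ∀ f, Measurable f → T f = (Φ.extend A Λ ρ₂ Set.univ)⁻¹ * ∫⁻ ζ, f ζ ∂ρ₂ := by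
    intro f hf
    simp only [hT]
    rw [heq, lintegral_smul_measure, lintegral_extend_inv h hm hA hA0 Λ ρ₂ hf, smul_eq_mul]
  have hN : (Φ.extend A Λ ρ Set.univ)⁻¹ = (Φ.extend A Λ ρ₂ Set.univ)⁻¹ := by
    have := (h1 1 measurable_one).symm.trans (h2 1 measurable_one)
    simpa only [Pi.one_apply, lintegral_one, measure_univ, mul_one] using this
  ext B hB
  have := (h1 _ (measurable_one.indicator hB)).symm.trans (h2 _ (measurable_one.indicator hB))
  rw [lintegral_indicator_one hB, lintegral_indicator_one hB, ← hN] at this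
  exact (ENNReal.mul_right_inj (ENNReal.inv_ne_zero.2 (extend_univ_ne_top h hm hA Λ ρ))
    (ENNReal.inv_ne_top.2 (extend_univ_ne_zero h hm hA hA0 Λ ρ))).1 this

end Potential

end RotatorPCA

namespace RotatorPCA

open Function Filter Topology

/-! ### The second-layer specification and its relation to the first layer -/

namespace Potential

variable {I : Type} [DecidableEq I] {q : ℕ} {Φ : Potential I}

/-- The unconstrained Boltzmann weights. -/
noncomputable abbrev freeWeight (Φ : Potential I) : Finset I → (I → Angle) → ℝ≥0∞ :=
  Φ.weight fun _ => Set.univ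

/-- The arcs partition the circle, so only the discretization of `σ` itself contributes. -/
lemma sum_arcWeight [NeZero q] (Λ : Finset I) (ζ : {i // i ∉ Λ} → ZMod q) (σ : I → Angle) :
    ∑ ω : Λ → ZMod q, Φ.arcWeight q (join Λ ω ζ) Λ σ = Φ.freeWeight Λ σ := by
  rw [Finset.sum_eq_single fun i : Λ => disc q (σ i)]
  · rw [arcWeight, freeWeight, weight, weight, Set.indicator_of_mem, Set.indicator_of_mem]
    · exact fun i _ => Set.mem_univ _
    · intro i hi
      simp [join_of_mem hi, arc]
  · intro ω _ hω
    refine Set.indicator_of_notMem (fun hσ => hω ?_) _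
    ext i
    have : disc q (σ i) = join Λ ω ζ i := hσ i i.2
    rw [this, join_of_mem i.2]
  · simp

variable [Countable I]

lemma lintegral_extend_eq (h : Φ.AbsolutelySummable) (hm : ∀ A, Measurable (Φ A))
    {A : I → Set Angle} (hA : ∀ i, MeasurableSet (A i)) (Λ : Finset I)
    (ρ : Measure ({i // i ∉ Λ} → Angle)) {f : (I → Angle) → ℝ≥0∞} (hf : Measurable f) :
    ∫⁻ σ, f σ ∂Φ.extend A Λ ρ = ∫⁻ σ, Φ.weight A Λ σ * f σ
      ∂(((Measure.pi fun _ : Λ => (volume : Measure Angle)).prod ρ).map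
        fun p => join Λ p.1 p.2) :=
  lintegral_withDensity_eq_lintegral_mul _ (measurable_weight h hm hA Λ) hf

lemma sum_lintegral_extend [NeZero q] (h : Φ.AbsolutelySummable) (hm : ∀ A, Measurable (Φ A))
    (Λ : Finset I) (ζ : {i // i ∉ Λ} → ZMod q) (ρ : Measure ({i // i ∉ Λ} → Angle))
    {f : (I → Angle) → ℝ≥0∞} (hf : Measurable f) :
    ∑ ω : Λ → ZMod q, ∫⁻ σ, f σ ∂Φ.extend (fun i => arc q (join Λ ω ζ i)) Λ ρ =
      ∫⁻ σ, f σ ∂Φ.extend (fun _ => Set.univ) Λ ρ := by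
  rw [lintegral_extend_eq h hm (fun _ => MeasurableSet.univ) Λ ρ hf]
  simp only [fun ω : Λ → ZMod q => lintegral_extend_eq h hm
    (fun i => measurableSet_arc (join Λ ω ζ i)) Λ ρ hf]
  rw [← lintegral_finsetSum]
  · refine lintegral_congr fun σ => ?_
    rw [← Finset.sum_mul]
    congr 1
    exact sum_arcWeight Λ ζ σ
  · exact fun ω _ => (measurable_weight h hm (fun i => measurableSet_arc (join Λ ω ζ i)) Λ).mul hf

/-- Existence follows from compactness, as the restricted potential is still summable. For
uniqueness Dobrushin's condition is not checked again: it is inherited from the full model, with the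
constraint continued by `0` into `Λ`. -/
lemma existsUnique_isGibbs_restrict [NeZero q] (h : Φ.AbsolutelySummable)
    (hm : ∀ A, Measurable (Φ A)) (hu : ∀ σ', ∃! μ, IsGibbs (Φ.constrainedSpec q σ') μ)
    (Λ : Finset I) (κ : {i // i ∉ Λ} → ZMod q) :
    ∃! ρ, IsGibbs ((Φ.restrict fun i => i ∉ Λ).constrainedSpec q κ) ρ := by
  have hw := isWeight_arcWeight (q := q) (h.restrict fun i => i ∉ Λ)
    (measurable_restrict hm fun i => i ∉ Λ) κ
  obtain ⟨ρ, hρ⟩ := exists_isGibbs hw (boundedDensity_weight (h.restrict _)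
    (fun _ => measurableSet_arc _) fun _ => volume_arc_ne_zero _) (quasiLocal_weight (h.restrict _) _)
  have key : ∀ ρ ρ₂, IsGibbs (spec (volume : Measure Angle)
      ((Φ.restrict fun i => i ∉ Λ).arcWeight q κ)) ρ →
      IsGibbs (spec (volume : Measure Angle)
      ((Φ.restrict fun i => i ∉ Λ).arcWeight q κ)) ρ₂ → ρ = ρ₂ := by
    intro ρ ρ₂ h1 h2
    have hA : ((Φ.restrict fun i => i ∉ Λ).arcWeight q κ) = (Φ.restrict fun i => i ∉ Λ).weight
        (fun i => (fun i => arc q (join Λ 0 κ i)) (i : I)) := by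
      simp only [arcWeight, join_apply_compl]
    rw [hA] at h1 h2
    refine eq_of_isGibbs_restrict h hm (fun _ => measurableSet_arc _)
      (fun _ => volume_arc_ne_zero _) (fun μ μ₂ hμ hμ₂ => ?_) Λ h1 h2
    have hu' := hu (join Λ 0 κ)
    rw [constrainedSpec_eq_spec] at hu'
    exact hu'.unique hμ hμ₂
  refine ⟨ρ, by rwa [constrainedSpec_eq_spec], fun ρ₂ hρ₂ => key _ _ ?_ hρ⟩
  dsimp only at hρ₂
  rwa [constrainedSpec_eq_spec] at hρ₂

lemma constrainedPartition_eq_lmarginal_join (Λ : Finset I) (ω : Λ → ZMod q)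
    (κ : {i // i ∉ Λ} → ZMod q) (ζ : {i // i ∉ Λ} → Angle) :
    Φ.constrainedPartition q Λ ω ζ = lmarginal (fun _ => (volume : Measure Angle)) Λ
      (Φ.arcWeight q (join Λ ω κ) Λ) (join Λ 0 ζ) := by
  rw [← constrainedPartition_eq_lmarginal, join_comp_coe, join_comp_subtype]

lemma measurable_constrainedPartition [NeZero q] (h : Φ.AbsolutelySummable)
    (hm : ∀ A, Measurable (Φ A)) (Λ : Finset I) (ω : Λ → ZMod q) :
    Measurable (Φ.constrainedPartition q Λ ω) := by
  simp only [funext (constrainedPartition_eq_lmarginal_join (Φ := Φ) Λ ω 0)]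
  exact ((measurable_weight h hm (fun _ => measurableSet_arc _) Λ).lmarginal _).comp
    (measurable_join_right 0)

lemma lintegral_exp_eq_lmarginal_join (Λ : Finset I) (ζ : {i // i ∉ Λ} → Angle) :
    ∫⁻ s : Λ → Angle, ENNReal.ofReal (Real.exp (-Φ.hamiltonian Λ (join Λ s ζ)))
      ∂(Measure.pi fun _ : Λ => (volume : Measure Angle)) =
    lmarginal (fun _ => (volume : Measure Angle)) Λ (Φ.freeWeight Λ) (join Λ 0 ζ) := by
  rw [lmarginal_join]
  simp [weight]

/-- The constrained Gibbs measure off `Λ`, with the interactions with `Λ` deleted. -/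
noncomputable abbrev outerGibbs (Φ : Potential I) (q : ℕ) (Λ : Finset I) (σ' : I → ZMod q) :
    Measure ({i // i ∉ Λ} → Angle) :=
  (Φ.restrict fun i => i ∉ Λ).constrainedGibbs q fun i => σ' i

section Coarse

variable [NeZero q]

lemma isProbabilityMeasure_outerGibbs (h : Φ.AbsolutelySummable) (hm : ∀ A, Measurable (Φ A))
    (hu : ∀ σ', ∃! μ, IsGibbs (Φ.constrainedSpec q σ') μ) (Λ : Finset I) (σ' : I → ZMod q) :
    IsProbabilityMeasure (Φ.outerGibbs q Λ σ') :=
  (isGibbs_constrainedGibbs (existsUnique_isGibbs_restrict h hm hu Λ _)).1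

lemma coarseWeight_eq (h : Φ.AbsolutelySummable) (hm : ∀ A, Measurable (Φ A))
    (hu : ∀ σ', ∃! μ, IsGibbs (Φ.constrainedSpec q σ') μ) (Λ : Finset I) (ω : Λ → ZMod q)
    (σ' : I → ZMod q) : Φ.coarseWeight q Λ ω σ' =
      Φ.extend (fun i => arc q (join Λ ω (fun i => σ' i) i)) Λ (Φ.outerGibbs q Λ σ') Set.univ := by
  have := isProbabilityMeasure_outerGibbs h hm hu Λ σ'
  rw [extend_univ h hm fun _ => measurableSet_arc _]
  simp only [coarseWeight, constrainedPartition_eq_lmarginal_join Λ ω fun i => σ' i]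

/-- The constrained Gibbs measure in terms of the constrained Gibbs measure off `Λ`. -/
lemma coarseWeight_mul_lintegral (h : Φ.AbsolutelySummable) (hm : ∀ A, Measurable (Φ A))
    (hu : ∀ σ', ∃! μ, IsGibbs (Φ.constrainedSpec q σ') μ) (Λ : Finset I) (ω : Λ → ZMod q)
    (σ' : I → ZMod q) (f : (I → Angle) → ℝ≥0∞) :
    Φ.coarseWeight q Λ ω σ' * ∫⁻ σ, f σ ∂Φ.constrainedGibbs q (join Λ ω fun i => σ' i) =
      ∫⁻ σ, f σ ∂Φ.extend (fun i => arc q (join Λ ω (fun i => σ' i) i)) Λ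
        (Φ.outerGibbs q Λ σ') := by
  have hp := isProbabilityMeasure_outerGibbs h hm hu Λ σ'
  have hG := isGibbs_constrainedGibbs (existsUnique_isGibbs_restrict h hm hu Λ fun i => σ' i)
  have hA : ((Φ.restrict fun i => i ∉ Λ).arcWeight q fun i => σ' i) =
      (Φ.restrict fun i => i ∉ Λ).weight
        (fun i => (fun i => arc q (join Λ ω (fun i => σ' i) i)) (i : I)) := by
    simp only [arcWeight, join_apply_compl]
  rw [constrainedSpec_eq_spec, hA] at hG
  -- The normalized extension of the outer measure is Gibbs for the full constrained model, so it is
  -- the constrained Gibbs measure. Its normalization is the coarse weight.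
  have hE := isGibbs_extend h hm (fun _ => measurableSet_arc _)
    (fun _ => volume_arc_ne_zero _) Λ hG
  have heq := eq_constrainedGibbs (hu (join Λ ω fun i => σ' i))
    (by rw [constrainedSpec_eq_spec]; exact hE)
  rw [← heq, lintegral_smul_measure, coarseWeight_eq h hm hu, smul_eq_mul, ← mul_assoc,
    ENNReal.mul_inv_cancel, one_mul]
  · exact extend_univ_ne_zero h hm (fun _ => measurableSet_arc _)
      (fun _ => volume_arc_ne_zero _) Λ _
  · exact extend_univ_ne_top h hm (fun _ => measurableSet_arc _) Λ _

lemma lintegral_coarseSpec (Λ : Finset I) (σ' : I → ZMod q) {F : (I → ZMod q) → ℝ≥0∞}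
    (hF : Measurable F) : ∫⁻ η, F η ∂Φ.coarseSpec q Λ σ' =
      ∑ ω : Λ → ZMod q, Φ.coarseWeight q Λ ω σ' / Φ.coarseTotal q Λ σ' *
        F (join Λ ω fun i => σ' i) := by
  rw [coarseSpec, lintegral_sum_measure, tsum_fintype]
  refine Finset.sum_congr rfl fun ω _ => ?_
  rw [lintegral_smul_measure, lintegral_dirac' _ hF, smul_eq_mul]

lemma measurable_outerGibbs (h : Φ.AbsolutelySummable) (hm : ∀ A, Measurable (Φ A))
    (hu : ∀ σ', ∃! μ, IsGibbs (Φ.constrainedSpec q σ') μ) (Λ : Finset I) :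
    Measurable (Φ.outerGibbs q Λ) := by
  have h1 := measurable_constrainedGibbs (h.restrict fun i => i ∉ Λ)
    (measurable_restrict hm fun i => i ∉ Λ) (existsUnique_isGibbs_restrict h hm hu Λ)
  have h2 : Measurable fun (σ' : I → ZMod q) (i : {i // i ∉ Λ}) => σ' i :=
    measurable_pi_lambda _ fun i => measurable_pi_apply (i : I)
  simpa only [comp_def] using h1.comp h2

lemma measurable_coarseSpec (h : Φ.AbsolutelySummable) (hm : ∀ A, Measurable (Φ A))
    (hu : ∀ σ', ∃! μ, IsGibbs (Φ.constrainedSpec q σ') μ) (Λ : Finset I) :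
    Measurable (Φ.coarseSpec q Λ) := by
  have hO := measurable_outerGibbs h hm hu Λ
  have h1 : ∀ ω, Measurable (Φ.coarseWeight q Λ ω) := fun ω =>
    (Measure.measurable_lintegral (measurable_constrainedPartition h hm Λ ω)).comp hO
  have h2 : Measurable (Φ.coarseTotal q Λ) := by
    have : Measurable fun ζ : {i // i ∉ Λ} → Angle =>
        ∫⁻ s : Λ → Angle, ENNReal.ofReal (Real.exp (-Φ.hamiltonian Λ (join Λ s ζ)))
          ∂(Measure.pi fun _ : Λ => (volume : Measure Angle)) := by
      simp only [lintegral_exp_eq_lmarginal_join]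
      exact ((measurable_weight h hm (fun _ => MeasurableSet.univ) Λ).lmarginal _).comp
        (measurable_join_right 0)
    exact (Measure.measurable_lintegral this).comp hO
  have h3 : ∀ ω : Λ → ZMod q, Measurable fun σ' : I → ZMod q => join Λ ω fun i => σ' i := by
    intro ω
    have h4 : Measurable fun (σ' : I → ZMod q) (i : {i // i ∉ Λ}) => σ' i :=
      measurable_pi_lambda _ fun i => measurable_pi_apply (i : I)
    simpa only [comp_def] using (measurable_join_right ω).comp h4
  refine Measure.measurable_of_measurable_coe _ fun B hB => ?_
  have hB1 : Measurable (B.indicator (1 : (I → ZMod q) → ℝ≥0∞)) := measurable_one.indicator hB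
  have : ∀ σ', Φ.coarseSpec q Λ σ' B = ∑ ω : Λ → ZMod q, Φ.coarseWeight q Λ ω σ' /
      Φ.coarseTotal q Λ σ' * B.indicator 1 (join Λ ω fun i => σ' i) := fun σ' => by
    rw [← lintegral_coarseSpec Λ σ' hB1, lintegral_indicator_one hB]
  simp only [this]
  exact Finset.measurable_sum _ fun ω _ => ((h1 ω).div h2).mul (hB1.comp (h3 ω))

lemma lintegral_lintegral_coarseSpec (h : Φ.AbsolutelySummable) (hm : ∀ A, Measurable (Φ A))
    (hu : ∀ σ', ∃! μ, IsGibbs (Φ.constrainedSpec q σ') μ) {μ' : Measure (I → ZMod q)}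
    (hμ' : IsGibbs (Φ.coarseSpec q) μ') (Λ : Finset I) {F : (I → ZMod q) → ℝ≥0∞}
    (hF : Measurable F) :
    ∫⁻ σ', ∫⁻ η, F η ∂Φ.coarseSpec q Λ σ' ∂μ' = ∫⁻ σ', F σ' ∂μ' := by
  have hc := measurable_coarseSpec h hm hu Λ
  have hb : μ'.bind (Φ.coarseSpec q Λ) = μ' := by
    ext B hB
    rw [Measure.bind_apply hB hc.aemeasurable, hμ'.2 Λ B hB]
  conv_rhs => rw [← hb]
  rw [Measure.lintegral_bind hc.aemeasurable hF.aemeasurable]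

/-- Filling a Gibbs measure of the second layer with constrained Gibbs measures gives a Gibbs
measure of the first layer. -/
lemma dlr_bind_gibbsKernel (h : Φ.AbsolutelySummable) (hm : ∀ A, Measurable (Φ A))
    (hu : ∀ σ', ∃! μ, IsGibbs (Φ.constrainedSpec q σ') μ) {μ' : Measure (I → ZMod q)}
    (hμ' : IsGibbs (Φ.coarseSpec q) μ') (Λ : Finset I) :
    DLR (volume : Measure Angle) Φ.freeWeight Λ (μ'.bind (gibbsKernel h hm hu)) := by
  have hw : IsWeight (volume : Measure Angle) Φ.freeWeight :=
    isWeight_weight h hm (fun _ => MeasurableSet.univ) fun _ => by simp [Real.pi_pos]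
  -- Averaging with `γ'_Λ` multiplies each constrained Gibbs measure by its normalization, leaving
  -- extensions of one outer measure. Their sum over `ω` is the unconstrained extension, so `f`
  -- enters only through the integral over `Λ` of `freeWeight * f`.
  have key : ∀ f : (I → Angle) → ℝ≥0∞, Measurable f →
      ∫⁻ σ, f σ ∂μ'.bind (gibbsKernel h hm hu) = ∫⁻ σ', (Φ.coarseTotal q Λ σ')⁻¹ *
        ∫⁻ ζ, lmarginal (fun _ => (volume : Measure Angle)) Λ
          (fun σ => Φ.freeWeight Λ σ * f σ) (join Λ 0 ζ) ∂Φ.outerGibbs q Λ σ' ∂μ' := by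
    intro f hf
    rw [Measure.lintegral_bind (Kernel.measurable _).aemeasurable hf.aemeasurable,
      ← lintegral_lintegral_coarseSpec h hm hu hμ' Λ hf.lintegral_kernel]
    refine lintegral_congr fun σ' => ?_
    have hp := isProbabilityMeasure_outerGibbs h hm hu Λ σ'
    rw [lintegral_coarseSpec Λ σ' hf.lintegral_kernel,
      ← lintegral_extend h hm (fun _ => MeasurableSet.univ) Λ _ hf,
      ← sum_lintegral_extend h hm Λ (fun i => σ' i) (Φ.outerGibbs q Λ σ') hf, Finset.mul_sum]
    refine Finset.sum_congr rfl fun ω _ => ?_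
    rw [← coarseWeight_mul_lintegral h hm hu Λ ω σ' f, ← mul_assoc, ENNReal.div_eq_inv_mul]
    rfl
  intro f hf
  rw [key f hf, key _ (measurable_avg hw Λ hf)]
  simp only [lmarginal_weight_mul_avg hw Λ]

end Coarse

end Potential

end RotatorPCA

namespace RotatorPCA

open Function Filter Topology

/-! ### Rotations of first-layer Gibbs measures -/

/-- The joint rotation of all spins by the angle `t`. -/
noncomputable def rotate {I : Type} (t : Angle) (σ : I → Angle) : I → Angle := fun i => σ i + t

/-- The sitewise discretization. -/
noncomputable def discretize {I : Type} (q : ℕ) (σ : I → Angle) : I → ZMod q := fun i => disc q (σ i)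

lemma measurable_rotate {I : Type} (t : Angle) : Measurable (rotate t : (I → Angle) → I → Angle) :=
  measurable_pi_lambda _ fun i =>
    (measurable_add_const t).comp (measurable_pi_apply (X := fun _ : I => Angle) i)

lemma measurable_discretize {I : Type} (q : ℕ) :
    Measurable (discretize q : (I → Angle) → I → ZMod q) :=
  measurable_pi_lambda _ fun i => measurable_disc.comp (measurable_pi_apply i)

namespace Potential

variable {I : Type} [DecidableEq I] {q : ℕ} {Φ : Potential I}

section Rotation

/-- Translation invariance of Lebesgue measure on the circle, applied to one spin at a time. -/
lemma lmarginal_comp_rotate (t : Angle) (V : Finset I) {f : (I → Angle) → ℝ≥0∞} (hf : Measurable f)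
    (σ : I → Angle) :
    lmarginal (fun _ => (volume : Measure Angle)) V (fun σ => f (rotate t σ)) σ =
      lmarginal (fun _ => (volume : Measure Angle)) V f (rotate t σ) := by
  have hfr : Measurable fun σ => f (rotate t σ) := hf.comp (measurable_rotate t)
  induction V using Finset.induction_on generalizing σ with
  | empty => simp
  | insert i V hi ih =>
    rw [lmarginal_insert _ hfr hi, lmarginal_insert _ hf hi]
    have hup : ∀ x : Angle, rotate t (Function.update σ i x) = Function.update (rotate t σ) i (x + t) := by
      intro x
      ext k
      rcases eq_or_ne k i with rfl | hk
      · simp [rotate]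
      · simp [rotate, hk]
    simp only [ih, hup]
    exact lintegral_add_right_eq_self (fun x => lmarginal (fun _ => (volume : Measure Angle)) V f
      (Function.update (rotate t σ) i x)) t

lemma freeWeight_rotate (hrot : Φ.RotationInvariant) (t : Angle) (V : Finset I) (σ : I → Angle) :
    Φ.freeWeight V (rotate t σ) = Φ.freeWeight V σ := by
  have : Φ.hamiltonian V (rotate t σ) = Φ.hamiltonian V σ :=
    tsum_congr fun A => hrot t A.1 fun a => σ a
  simp [weight, this]

lemma avg_freeWeight_rotate [Countable I] (h : Φ.AbsolutelySummable) (hm : ∀ A, Measurable (Φ A))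
    (hrot : Φ.RotationInvariant) (t : Angle) (V : Finset I) {f : (I → Angle) → ℝ≥0∞}
    (hf : Measurable f) (σ : I → Angle) :
    avg (volume : Measure Angle) Φ.freeWeight V f (rotate t σ) =
      avg (volume : Measure Angle) Φ.freeWeight V (fun σ => f (rotate t σ)) σ := by
  have hw : Measurable (Φ.freeWeight V) := measurable_weight h hm (fun _ => MeasurableSet.univ) V
  have hwf : Measurable fun σ => Φ.freeWeight V σ * f σ := hw.mul hf
  rw [avg, avg, ← lmarginal_comp_rotate t V hw, ← lmarginal_comp_rotate t V hwf]
  simp only [freeWeight_rotate hrot]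

lemma dlr_map_rotate [Countable I] (h : Φ.AbsolutelySummable) (hm : ∀ A, Measurable (Φ A))
    (hrot : Φ.RotationInvariant) (t : Angle) {V : Finset I} {μ : Measure (I → Angle)}
    (hμ : DLR (volume : Measure Angle) Φ.freeWeight V μ) :
    DLR (volume : Measure Angle) Φ.freeWeight V (μ.map (rotate t)) := by
  have hw : IsWeight (volume : Measure Angle) Φ.freeWeight :=
    isWeight_weight h hm (fun _ => MeasurableSet.univ) fun _ => by simp [Real.pi_pos]
  intro f hf
  rw [lintegral_map (measurable_avg hw V hf) (measurable_rotate t),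
    lintegral_map hf (measurable_rotate t)]
  simp only [avg_freeWeight_rotate h hm hrot t V hf]
  exact hμ _ (hf.comp (measurable_rotate t))

end Rotation

/-! ### Conditioning a first-layer Gibbs measure on its discretization -/

section Disintegration

variable [Countable I] [NeZero q]

/-- Under the unconstrained specification, conditioning on the discretization gives the constrained
specification. -/
lemma avg_freeWeight_avg_arcWeight (h : Φ.AbsolutelySummable) (hm : ∀ A, Measurable (Φ A))
    (V : Finset I) {g : (I → ZMod q) → ℝ≥0∞} (hg : Measurable g) {f : (I → Angle) → ℝ≥0∞}
    (hf : Measurable f) (η : I → Angle) :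
    avg (volume : Measure Angle) Φ.freeWeight V (fun σ => g (discretize q σ) *
      avg (volume : Measure Angle) (Φ.arcWeight q (discretize q σ)) V f σ) η =
    avg (volume : Measure Angle) Φ.freeWeight V (fun σ => g (discretize q σ) * f σ) η := by
  set κ : {i // i ∉ V} → ZMod q := fun i => discretize q η i with hκ
  -- Where the constrained weight does not vanish, the discretization is constant. After splitting
  -- the free weight over `ω`, the discretization in `g` and in the constrained kernel can be frozen
  -- at `join V ω κ`.
  have hdisc : ∀ (ω : V → ZMod q) (y : V → Angle),
      Φ.arcWeight q (join V ω κ) V (updateFinset η V y) ≠ 0 →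
      discretize q (updateFinset η V y) = join V ω κ := by
    intro ω y hy
    have hmem := Set.mem_of_indicator_ne_zero hy
    ext i
    by_cases hi : i ∈ V
    · exact hmem i hi
    · simp [discretize, updateFinset, hi, join_of_notMem hi, hκ]
  have hw := fun σ' => isWeight_arcWeight (q := q) h hm σ'
  have expand : ∀ G : (I → Angle) → ℝ≥0∞, Measurable G →
      lmarginal (fun _ => (volume : Measure Angle)) V (fun σ => Φ.freeWeight V σ * G σ) η =
      ∑ ω : V → ZMod q, lmarginal (fun _ => (volume : Measure Angle)) V
        (fun σ => Φ.arcWeight q (join V ω κ) V σ * G σ) η := by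
    intro G hG
    simp only [lmarginal]
    rw [← lintegral_finsetSum]
    · refine lintegral_congr fun y => ?_
      rw [← Finset.sum_mul, sum_arcWeight]
    · exact fun ω _ => (((hw _).measurable V).mul hG).comp measurable_updateFinset
  have hgd : Measurable fun σ : I → Angle => g (discretize q σ) :=
    hg.comp (measurable_discretize q)
  have havg : Measurable fun σ : I → Angle =>
      avg (volume : Measure Angle) (Φ.arcWeight q (discretize q σ)) V f σ := by
    have h1 := measurable_avg_arcWeight_prod (q := q) h hm V hf
    have h2 : Measurable fun σ : I → Angle => (discretize q σ, σ) :=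
      (measurable_discretize q).prodMk measurable_id
    simpa only [comp_def] using h1.comp h2
  rw [avg, avg, expand (fun σ => g (discretize q σ) *
      avg (volume : Measure Angle) (Φ.arcWeight q (discretize q σ)) V f σ) (hgd.mul havg),
    expand (fun σ => g (discretize q σ) * f σ) (hgd.mul hf)]
  congr 1
  refine Finset.sum_congr rfl fun ω _ => ?_
  have hpull : ∀ F : (I → ZMod q) → (I → Angle) → ℝ≥0∞, Measurable (F (join V ω κ)) →
      lmarginal (fun _ => (volume : Measure Angle)) V
        (fun σ => Φ.arcWeight q (join V ω κ) V σ * (g (discretize q σ) * F (discretize q σ) σ)) η =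
      g (join V ω κ) * lmarginal (fun _ => (volume : Measure Angle)) V
        (fun σ => Φ.arcWeight q (join V ω κ) V σ * F (join V ω κ) σ) η := by
    intro F hF
    simp only [lmarginal]
    have hF' : Measurable fun y : V → Angle => Φ.arcWeight q (join V ω κ) V (updateFinset η V y) *
        F (join V ω κ) (updateFinset η V y) :=
      (((hw _).measurable V).mul hF).comp measurable_updateFinset
    rw [← lintegral_const_mul _ hF']
    refine lintegral_congr fun y => ?_
    by_cases hy : Φ.arcWeight q (join V ω κ) V (updateFinset η V y) = 0
    · simp [hy]
    · rw [hdisc ω y hy, mul_left_comm]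
  rw [hpull (fun σ' σ => avg (volume : Measure Angle) (Φ.arcWeight q σ') V f σ)
    (measurable_avg (hw _) V hf), hpull (fun _ σ => f σ) hf,
    lmarginal_weight_mul_avg (hw (join V ω κ)) V]

/-- The constrained specification as a kernel, jointly in the constraint and in the boundary
condition. -/
noncomputable def specKernel (h : Φ.AbsolutelySummable) (hm : ∀ A, Measurable (Φ A)) (q : ℕ)
    [NeZero q] (V : Finset I) : Kernel ((I → ZMod q) × (I → Angle)) (I → Angle) where
  toFun p := spec (volume : Measure Angle) (Φ.arcWeight q p.1) V p.2
  measurable' := by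
    refine Measure.measurable_of_measurable_coe _ fun B hB => ?_
    simp only [fun p : (I → ZMod q) × (I → Angle) =>
      spec_apply (isWeight_arcWeight (q := q) h hm p.1) V p.2 hB]
    exact measurable_avg_arcWeight_prod h hm V (measurable_one.indicator hB)

lemma isMarkovKernel_specKernel (h : Φ.AbsolutelySummable) (hm : ∀ A, Measurable (Φ A))
    (V : Finset I) : IsMarkovKernel (specKernel h hm q V) :=
  ⟨fun p => isProbabilityMeasure_spec (isWeight_arcWeight (q := q) h hm p.1) V p.2⟩

/-- The conditional law of the spins of a first-layer Gibbs measure given their discretization is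
the constrained Gibbs measure. -/
theorem compProd_gibbsKernel (h : Φ.AbsolutelySummable) (hm : ∀ A, Measurable (Φ A))
    (hu : ∀ σ', ∃! μ, IsGibbs (Φ.constrainedSpec q σ') μ) {μ : Measure (I → Angle)}
    [IsProbabilityMeasure μ] (hμ : ∀ V, DLR (volume : Measure Angle) Φ.freeWeight V μ) :
    (μ.map (discretize q)) ⊗ₘ gibbsKernel h hm hu = μ.map fun σ => (discretize q σ, σ) := by
  have hT := measurable_discretize (I := I) q
  set κ := condDistrib (id : (I → Angle) → I → Angle) (discretize q) μ with hκ
  have hκμ : (μ.map (discretize q)) ⊗ₘ κ = μ.map fun σ => (discretize q σ, σ) :=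
    compProd_map_condDistrib aemeasurable_id
  have hlint : ∀ F : (I → ZMod q) × (I → Angle) → ℝ≥0∞, Measurable F →
      ∫⁻ σ', ∫⁻ σ, F (σ', σ) ∂κ σ' ∂(μ.map (discretize q)) = ∫⁻ σ, F (discretize q σ, σ) ∂μ := by
    intro F hF
    have h2 : Measurable fun σ : I → Angle => (discretize q σ, σ) := hT.prodMk measurable_id
    rw [← Measure.lintegral_compProd hF, hκμ, lintegral_map hF h2]
  -- The conditional law is almost surely invariant under the constrained kernel in `V`: applying
  -- that kernel does not change the joint law with the discretization, and a disintegration is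
  -- almost surely unique. The joint laws are compared on rectangles.
  have hV : ∀ V, ∀ᵐ σ' ∂(μ.map (discretize q)),
      κ σ' = Kernel.snd (κ ⊗ₖ specKernel h hm q V) σ' := by
    intro V
    have hMk := isMarkovKernel_specKernel (q := q) h hm V
    refine Kernel.ae_eq_of_compProd_eq ?_
    refine Measure.ext_prod (fun {S B} hS hB => ?_)
    have hBm : Measurable (B.indicator (1 : (I → Angle) → ℝ≥0∞)) := measurable_one.indicator hB
    have hSm : Measurable (S.indicator (1 : (I → ZMod q) → ℝ≥0∞)) := measurable_one.indicator hS
    have e1 : ∀ κ' : Kernel (I → ZMod q) (I → Angle), IsMarkovKernel κ' →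
        ((μ.map (discretize q)) ⊗ₘ κ') (S ×ˢ B) =
        ∫⁻ σ', S.indicator 1 σ' * κ' σ' B ∂(μ.map (discretize q)) := by
      intro κ' _
      rw [Measure.compProd_apply_prod hS hB, ← lintegral_indicator hS]
      refine lintegral_congr fun σ' => ?_
      by_cases hσ' : σ' ∈ S <;> simp [hσ']
    have e2 : ∀ σ', Kernel.snd (κ ⊗ₖ specKernel h hm q V) σ' B =
        ∫⁻ σ, avg (volume : Measure Angle) (Φ.arcWeight q σ') V (B.indicator 1) σ ∂κ σ' := by
      intro σ'
      rw [Kernel.snd_apply' _ _ hB, Kernel.compProd_apply (measurable_snd hB)]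
      refine lintegral_congr fun σ => ?_
      exact spec_apply (isWeight_arcWeight (q := q) h hm σ') V σ hB
    have hm1 : Measurable fun p : (I → ZMod q) × (I → Angle) =>
        S.indicator 1 p.1 * B.indicator (1 : (I → Angle) → ℝ≥0∞) p.2 :=
      (hSm.comp measurable_fst).mul (hBm.comp measurable_snd)
    have hm2 : Measurable fun p : (I → ZMod q) × (I → Angle) => S.indicator 1 p.1 *
        avg (volume : Measure Angle) (Φ.arcWeight q p.1) V (B.indicator 1) p.2 :=
      (hSm.comp measurable_fst).mul (measurable_avg_arcWeight_prod h hm V hBm)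
    rw [e1 _ inferInstance, e1 _ inferInstance]
    calc ∫⁻ σ', S.indicator 1 σ' * κ σ' B ∂(μ.map (discretize q))
        = ∫⁻ σ', ∫⁻ σ, S.indicator 1 σ' * B.indicator 1 σ ∂κ σ' ∂(μ.map (discretize q)) := by
          refine lintegral_congr fun σ' => ?_
          rw [lintegral_const_mul _ hBm, lintegral_indicator_one hB]
      _ = ∫⁻ σ, S.indicator 1 (discretize q σ) * B.indicator 1 σ ∂μ := hlint _ hm1
      _ = ∫⁻ σ, S.indicator 1 (discretize q σ) * avg (volume : Measure Angle)
            (Φ.arcWeight q (discretize q σ)) V (B.indicator 1) σ ∂μ := by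
          have h2 : Measurable fun σ : I → Angle => (discretize q σ, σ) := hT.prodMk measurable_id
          rw [← hμ V (fun σ => S.indicator 1 (discretize q σ) * B.indicator 1 σ)
            ((hSm.comp hT).mul hBm)]
          refine Eq.trans ?_ (hμ V _ (hm2.comp h2))
          exact lintegral_congr fun η => (avg_freeWeight_avg_arcWeight h hm V hSm hBm η).symm
      _ = ∫⁻ σ', ∫⁻ σ, S.indicator 1 σ' * avg (volume : Measure Angle)
            (Φ.arcWeight q σ') V (B.indicator 1) σ ∂κ σ' ∂(μ.map (discretize q)) :=
          (hlint _ hm2).symm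
      _ = ∫⁻ σ', S.indicator 1 σ' * Kernel.snd (κ ⊗ₖ specKernel h hm q V) σ' B
            ∂(μ.map (discretize q)) := by
          refine lintegral_congr fun σ' => ?_
          rw [e2, lintegral_const_mul _ (measurable_avg (isWeight_arcWeight (q := q) h hm σ') V hBm)]
  have hMK := isMarkovKernel_gibbsKernel h hm hu
  rw [← hκμ]
  refine Measure.compProd_congr ?_
  -- There are countably many finite volumes, so a single null set serves for all; off it, the
  -- conditional law is Gibbs for the constrained model and uniqueness identifies it.
  filter_upwards [ae_all_iff.2 hV] with σ' hσ'
  refine (eq_constrainedGibbs (hu σ') ⟨inferInstance, fun V B hB => ?_⟩).symm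
  have hMk := isMarkovKernel_specKernel (q := q) h hm V
  conv_rhs => rw [hσ' V, Kernel.snd_apply' _ _ hB, Kernel.compProd_apply (measurable_snd hB)]
  rw [constrainedSpec_eq_spec]
  rfl

end Disintegration

end Potential

end RotatorPCA

namespace RotatorPCA

/-! ### Time reversal -/

namespace Potential

variable {I : Type} [DecidableEq I] [Countable I] {q : ℕ} [NeZero q] {Φ : Potential I}

/-- The transition operator `M_τ` as a kernel. -/
noncomputable def updateKernel (h : Φ.AbsolutelySummable) (hm : ∀ A, Measurable (Φ A))
    (hu : ∀ σ', ∃! μ, IsGibbs (Φ.constrainedSpec q σ') μ) (τ : ℝ) :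
    Kernel (I → ZMod q) (I → ZMod q) :=
  (gibbsKernel h hm hu).map fun σ => discretize q (rotate (τ : Angle) σ)

lemma measurable_discretize_rotate (q : ℕ) (t : Angle) :
    Measurable fun σ : I → Angle => discretize q (rotate t σ) :=
  (measurable_discretize q).comp (measurable_rotate t)

lemma updateKernel_apply (h : Φ.AbsolutelySummable) (hm : ∀ A, Measurable (Φ A))
    (hu : ∀ σ', ∃! μ, IsGibbs (Φ.constrainedSpec q σ') μ) (τ : ℝ) (σ' : I → ZMod q) :
    updateKernel h hm hu τ σ' = Φ.update q τ σ' :=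
  Kernel.map_apply _ (measurable_discretize_rotate q _) σ'

lemma isMarkovKernel_updateKernel (h : Φ.AbsolutelySummable) (hm : ∀ A, Measurable (Φ A))
    (hu : ∀ σ', ∃! μ, IsGibbs (Φ.constrainedSpec q σ') μ) (τ : ℝ) :
    IsMarkovKernel (updateKernel h hm hu τ) := by
  have := isMarkovKernel_gibbsKernel h hm hu
  exact Kernel.IsMarkovKernel.map _ (measurable_discretize_rotate q _)

lemma lintegral_updateKernel (h : Φ.AbsolutelySummable) (hm : ∀ A, Measurable (Φ A))
    (hu : ∀ σ', ∃! μ, IsGibbs (Φ.constrainedSpec q σ') μ) (τ : ℝ) (σ' : I → ZMod q)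
    {f : (I → ZMod q) → ℝ≥0∞} (hf : Measurable f) :
    ∫⁻ η', f η' ∂updateKernel h hm hu τ σ' =
      ∫⁻ σ, f (discretize q (rotate (τ : Angle) σ)) ∂gibbsKernel h hm hu σ' := by
  rw [updateKernel, Kernel.lintegral_map _ (measurable_discretize_rotate q _) _ hf]

/-- Time reversal of the updating: the joint law of the configurations before and after the
rotation by `τ` is the law for the rotation by `-τ`, with exchanged coordinates. -/
theorem compProd_updateKernel_neg (h : Φ.AbsolutelySummable) (hm : ∀ A, Measurable (Φ A))
    (hrot : Φ.RotationInvariant) (hu : ∀ σ', ∃! μ, IsGibbs (Φ.constrainedSpec q σ') μ) (τ : ℝ)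
    {μ' : Measure (I → ZMod q)} (hμ' : IsGibbs (Φ.coarseSpec q) μ') :
    (μ'.bind (updateKernel h hm hu τ)) ⊗ₘ updateKernel h hm hu (-τ) =
      (μ' ⊗ₘ updateKernel h hm hu τ).map Prod.swap := by
  have hp := hμ'.1
  have hK := isMarkovKernel_gibbsKernel h hm hu
  have hM := isMarkovKernel_updateKernel h hm hu
  set t : Angle := (τ : Angle) with ht
  set K := gibbsKernel h hm hu with hKdef
  set μ : Measure (I → Angle) := μ'.bind K with hμ
  have hμp : IsProbabilityMeasure μ := by rw [hμ]; infer_instance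
  have hr := measurable_rotate (I := I) t
  have hμtp : IsProbabilityMeasure (μ.map (rotate t)) :=
    Measure.isProbabilityMeasure_map hr.aemeasurable
  -- The rotated measure is Gibbs for the first layer, so given its discretization its spins follow
  -- the constrained Gibbs measure.
  have hdis := compProd_gibbsKernel h hm hu (μ := μ.map (rotate t)) fun V =>
    dlr_map_rotate h hm hrot t (dlr_bind_gibbsKernel h hm hu hμ' V)
  have hbind : μ'.bind (updateKernel h hm hu τ) = (μ.map (rotate t)).map (discretize q) := by
    rw [Measure.map_map (measurable_discretize q) hr]
    ext B hB
    have hB1 : Measurable (B.indicator (1 : (I → ZMod q) → ℝ≥0∞)) := measurable_one.indicator hB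
    have hd : Measurable (discretize q ∘ rotate (I := I) t) := measurable_discretize_rotate q t
    have hBd : Measurable fun σ : I → Angle =>
        B.indicator (1 : (I → ZMod q) → ℝ≥0∞) ((discretize q ∘ rotate t) σ) := hB1.comp hd
    rw [← lintegral_indicator_one hB, ← lintegral_indicator_one hB,
      Measure.lintegral_bind (Kernel.measurable _).aemeasurable hB1.aemeasurable,
      lintegral_map hB1 hd, hμ, Measure.lintegral_bind (Kernel.measurable _).aemeasurable
        hBd.aemeasurable]
    exact lintegral_congr fun σ' => lintegral_updateKernel h hm hu τ σ' hB1
  refine Measure.ext_of_lintegral _ fun F hF => ?_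
  have hFs : ∀ σ' : I → ZMod q, Measurable fun η' => F (η', σ') := fun σ' =>
    hF.comp measurable_prodMk_right
  have hG : Measurable fun σ : I → Angle =>
      F (discretize q (rotate t σ), discretize q σ) :=
    hF.comp ((measurable_discretize_rotate q t).prodMk (measurable_discretize q))
  -- The spins drawn given `σ'` discretize to `σ'`, so the old state can be read off from `σ` and
  -- both coordinates become functions of one configuration.
  have hright : ∫⁻ p, F p ∂(μ' ⊗ₘ updateKernel h hm hu τ).map Prod.swap =
      ∫⁻ σ, F (discretize q (rotate t σ), discretize q σ) ∂μ := by
    have hFsw : Measurable fun p : (I → ZMod q) × (I → ZMod q) => F p.swap :=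
      hF.comp measurable_swap
    rw [lintegral_map hF measurable_swap, Measure.lintegral_compProd hFsw, hμ,
      Measure.lintegral_bind (Kernel.measurable _).aemeasurable hG.aemeasurable]
    refine lintegral_congr fun σ' => ?_
    refine (lintegral_updateKernel h hm hu τ σ' (hFs σ')).trans ?_
    refine lintegral_congr_ae ?_
    filter_upwards [ae_disc_eq_constrainedGibbs h hm (hu σ')] with σ hσ
    have : discretize q σ = σ' := hσ
    rw [this]
  have hneg : ∀ σ : I → Angle, rotate ((-τ : ℝ) : Angle) (rotate t σ) = σ := by
    intro σ
    ext i
    simp [rotate, ht]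
  have hH : Measurable fun p : (I → ZMod q) × (I → Angle) =>
      F (p.1, discretize q (rotate ((-τ : ℝ) : Angle) p.2)) :=
    hF.comp (measurable_fst.prodMk ((measurable_discretize_rotate q _).comp measurable_snd))
  have hpair : Measurable fun σ : I → Angle => (discretize q σ, σ) :=
    (measurable_discretize q).prodMk measurable_id
  rw [hright, hbind, Measure.lintegral_compProd hF]
  calc ∫⁻ η', ∫⁻ σ', F (η', σ') ∂updateKernel h hm hu (-τ) η'
        ∂(μ.map (rotate t)).map (discretize q)
      = ∫⁻ η', ∫⁻ σ, F (η', discretize q (rotate ((-τ : ℝ) : Angle) σ)) ∂K η'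
        ∂(μ.map (rotate t)).map (discretize q) :=
        lintegral_congr fun η' => lintegral_updateKernel h hm hu (-τ) η'
          (hF.comp measurable_prodMk_left)
    _ = ∫⁻ p, F (p.1, discretize q (rotate ((-τ : ℝ) : Angle) p.2))
        ∂(((μ.map (rotate t)).map (discretize q)) ⊗ₘ K) := (Measure.lintegral_compProd hH).symm
    _ = ∫⁻ σ, F (discretize q σ, discretize q (rotate ((-τ : ℝ) : Angle) σ)) ∂μ.map (rotate t) := by
        rw [hdis, lintegral_map hH hpair]
    _ = ∫⁻ σ, F (discretize q (rotate t σ), discretize q σ) ∂μ := by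
        have hHp : Measurable fun σ : I → Angle =>
            F (discretize q σ, discretize q (rotate ((-τ : ℝ) : Angle) σ)) := hH.comp hpair
        rw [lintegral_map hHp hr]
        simp only [hneg]

end Potential

end RotatorPCA

theorem mainTheorem7 (d q : ℕ) [NeZero q]
    (Φ : RotatorPCA.Potential (Fin d → ℤ))
    (hmeas : ∀ A, Measurable (Φ A))
    (hsum : Φ.AbsolutelySummable)
    (hrot : Φ.RotationInvariant)
    (htrans : Φ.TranslationInvariant)
    (hdob : Φ.ConstrainedDobrushin q) :
    ∃ (M : ℝ → Kernel ((Fin d → ℤ) → ZMod q) ((Fin d → ℤ) → ZMod q))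
      (_ : ∀ τ, IsMarkovKernel (M τ)),
      (∀ τ σ', M τ σ' = Φ.update q τ σ') ∧
      ∀ (τ : ℝ) (μ' : Measure ((Fin d → ℤ) → ZMod q)) [IsProbabilityMeasure μ'],
        RotatorPCA.IsGibbs (Φ.coarseSpec q) μ' →
        RotatorPCA.ShiftInvariant μ' →
        (posterior (M τ) μ' =ᵐ[μ'.bind (M τ)] M (-τ)) ∧
        ∀ f : ((Fin d → ℤ) → ZMod q) → ((Fin d → ℤ) → ZMod q) → ℝ,
          Measurable (Function.uncurry f) → (∃ C, ∀ σ' η', |f σ' η'| ≤ C) →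
          ∫ σ', ∫ η', f σ' η' ∂(M τ σ') ∂μ' =
            ∫ η', ∫ σ', f σ' η' ∂(M (-τ) η') ∂(μ'.bind (M τ)) := by
  have hu := fun σ' => Φ.existsUnique_isGibbs hsum hmeas hdob σ'
  have hM := RotatorPCA.Potential.isMarkovKernel_updateKernel hsum hmeas hu
  refine ⟨RotatorPCA.Potential.updateKernel hsum hmeas hu, hM,
    RotatorPCA.Potential.updateKernel_apply hsum hmeas hu, fun τ μ' _ hμ' _ => ?_⟩
  have hrev := RotatorPCA.Potential.compProd_updateKernel_neg hsum hmeas hrot hu τ hμ'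
  -- The posterior is characterized almost everywhere by the joint law with exchanged coordinates,
  -- and `hrev` is that identity; integrating a bounded `f` against it gives the remaining formula.
  refine ⟨(ae_eq_posterior_of_compProd_eq hrev).symm, fun f hf hC => ?_⟩
  obtain ⟨C, hC⟩ := hC
  set M := RotatorPCA.Potential.updateKernel hsum hmeas hu
  have hint : Integrable (Function.uncurry f) (μ' ⊗ₘ M τ) :=
    Integrable.of_bound hf.aestronglyMeasurable C (ae_of_all _ fun p => hC p.1 p.2)
  have hfs : Measurable fun p : ((Fin d → ℤ) → ZMod q) × ((Fin d → ℤ) → ZMod q) => f p.2 p.1 :=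
    hf.comp measurable_swap
  have hint' : Integrable (fun p : ((Fin d → ℤ) → ZMod q) × ((Fin d → ℤ) → ZMod q) => f p.2 p.1)
      ((μ'.bind (M τ)) ⊗ₘ M (-τ)) :=
    Integrable.of_bound hfs.aestronglyMeasurable C (ae_of_all _ fun p => hC p.2 p.1)
  have h1 := Measure.integral_compProd hint
  have h2 := Measure.integral_compProd hint'
  rw [hrev, integral_map measurable_swap.aemeasurable hfs.aestronglyMeasurable] at h2
  exact h1.symm.trans h2
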